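/- Let $0<s\le 1$ and let $U$ be uniform on $[0,1]$. For every $n$, let each edge $e$ of the complete digraph $\vec K_n$ on $n$ vertices have a random weight $W_e$ and a random cost $C_e$, where all the weights and costs are i.i.d. copies of $U^s$. A spanning arborescence is a spanning rooted tree in which every edge is directed away from the root; put $W(A)=\sum_{e\in A}W_e$ and $C(A)=\sum_{e\in A}C_e$. Let $c_0=c_0(n)>0$ satisfy $$n^{1-s}\log n\ll c_0\ll \frac{n}{\log n},$$ where $a_n\ll b_n$ means $a_n/b_n\to 0$, and let $W^*_{arb}$ be the minimum of $W(A)$ over all spanning arborescences $A$ of $\vec K_n$ with $C(A)\le c_0$. Then there is a deterministic sequence $\varepsilon(n)\to 0$ such that, with probability tending to $1$ as $n\to\infty$, the problem is feasible and $$(1-\varepsilon(n))\,W^*_{arb}\le \frac{C_s^2\,n^{2-s}}{4c_0}\le (1+\varepsilon(n))\,W^*_{arb},$$ where $$C_s=\Gamma\left(\frac s2+1\right)\left(\frac{\Gamma(2/s+1)}{\Gamma(1/s+1)^2}\right)^{s/2}.$$ -/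

import Mathlib

open MeasureTheory ProbabilityTheory Filter Asymptotics
open scoped Topology

noncomputable section

namespace CostArb

/-- The directed edges of the complete digraph on the vertex set `Fin n` (no loops, both
orientations of every pair). -/
abbrev Edge (n : ℕ) : Type := {e : Fin n × Fin n // e.1 ≠ e.2}

/-- The vertex set `Fin n`, regarded as the vertex set of the spanning subdigraph of the complete
digraph whose set of edges is `A`. -/
def Spanning {n : ℕ} (_A : Finset (Edge n)) : Type := Fin n

/-- The arrows from `u` to `v` in the spanning subdigraph with edge set `A` are the edges in `A`
with tail `u` and head `v` (so there is at most one). -/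
instance {n : ℕ} (A : Finset (Edge n)) : Quiver.{0} (Spanning A) where
  Hom (u v : Fin n) := {e : Edge n // e ∈ A ∧ e.1.1 = u ∧ e.1.2 = v}

/-- `A` is the edge set of a spanning arborescence of the complete digraph on `Fin n`: there is a
root from which every vertex is reached by exactly one directed path along edges of `A`, i.e.
`A` is a rooted tree on all the vertices with every edge directed away from the root. -/
def IsSpanningArborescence {n : ℕ} (A : Finset (Edge n)) : Prop :=
  Nonempty (Quiver.Arborescence (Spanning A))

/-- The total weights `W(A)` of the spanning arborescences `A` with total cost `C(A) ≤ c`. -/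
def feasibleWeights {n : ℕ} (W C : Edge n → ℝ) (c : ℝ) : Set ℝ :=
  {w | ∃ A : Finset (Edge n), IsSpanningArborescence A ∧ ∑ e ∈ A, C e ≤ c ∧ w = ∑ e ∈ A, W e}

/-- The problem of minimising `W(A)` over the spanning arborescences `A` with `C(A) ≤ c` is
feasible and `w` is its optimum value. -/
def IsOptimalWeight {n : ℕ} (W C : Edge n → ℝ) (c w : ℝ) : Prop :=
  IsLeast (feasibleWeights W C c) w

/-- The law of `U ^ s`, where `U` is uniform on `[0, 1]`. -/
def uniformPow (s : ℝ) : Measure ℝ :=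
  (volume.restrict (Set.Icc (0 : ℝ) 1)).map (fun u => u ^ s)

/-- The constant `C_s`. -/
def Cs (s : ℝ) : ℝ :=
  Real.Gamma (s / 2 + 1) *
    (Real.Gamma (2 / s + 1) / Real.Gamma (1 / s + 1) ^ 2) ^ (s / 2)

end CostArb

end

namespace CostArb

/-! The proof is Lagrangian relaxation. For a multiplier `l`, give each edge the length `weight + l
* cost` and let every vertex choose its shortest incoming edge; `lagrangeSum l` is the total length
chosen. It bounds the length of any arborescence from below, up to the one edge that the root lacks
(`lagrangeSum_sub_le`).

For small `t` an edge has length at most `t` with probability `K * t ^ (2 / s) * l ^ (-1 / s)`,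
where `K = volConst s` (`edgeLaw_le`). Hence the minimum of `n - 1` lengths, divided by `√l * n ^
(-s / 2)`, has limiting tail `exp (-K * y ^ (2 / s))`, whose integral is `Cs s`. Distinct heads are
independent, so Chebyshev's inequality concentrates `lagrangeSum l` at `Cs s * n ^ (1 - s / 2) * √l`
(`tendsto_modelLaw_not_concentrated`).

Let `V` be the claimed optimum (`limitWeight`). At `l = q ^ 2 * V / c₀` the concentrated value is `2
* V * q`. Weak duality at `q = 1` gives the lower bound `2 * V - V = V`, up to lower order terms.
For the upper bound, take the best incoming edges at a `q` slightly above 1. Their total cost is a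
supergradient of the concave function `lagrangeSum`, so its values at two nearby multipliers force
the cost below `c₀` and the weight close to `V` (`supergradient_bounds`).

The chosen edges may contain cycles. A given edge is best for its head with probability at most `1 /
(n - 1)`, so there are `O(log n)` cycles in expectation (`sum_modelLaw_cycleEvent_le`). Redirecting
one vertex of each to a root adds at most 1 per vertex to weight and to cost
(`exists_isSpanningArborescence`), which is negligible because both `c₀` and `V` are of larger order
than `log n`. -/

/-! ### The law of the length of a single edge. -/

theorem measurable_rpow_left (s : ℝ) : Measurable (fun u : ℝ => u ^ s) := by fun_prop

theorem uniformPow_apply (s : ℝ) {A : Set ℝ} (hA : MeasurableSet A) :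
    uniformPow s A = volume ((fun u : ℝ => u ^ s) ⁻¹' A ∩ Set.Icc 0 1) := by
  rw [uniformPow, Measure.map_apply (measurable_rpow_left s) hA,
    Measure.restrict_apply (measurable_rpow_left s hA)]

instance isProbabilityMeasure_uniformPow (s : ℝ) : IsProbabilityMeasure (uniformPow s) := by
  constructor
  rw [uniformPow_apply s MeasurableSet.univ]
  simp

theorem uniformPow_Iic {s : ℝ} (hs : 0 < s) {c : ℝ} (hc0 : 0 ≤ c) (hc1 : c ≤ 1) :
    uniformPow s (Set.Iic c) = ENNReal.ofReal (c ^ (1 / s)) := by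
  have hset : (fun u : ℝ => u ^ s) ⁻¹' Set.Iic c ∩ Set.Icc 0 1 = Set.Icc 0 (c ^ (1 / s)) := by
    ext u
    simp only [Set.mem_inter_iff, Set.mem_preimage, Set.mem_Iic, Set.mem_Icc]
    constructor
    · rintro ⟨h, h0, -⟩
      refine ⟨h0, ?_⟩
      rwa [one_div, Real.le_rpow_inv_iff_of_pos h0 hc0 hs]
    · rintro ⟨h0, h⟩
      refine ⟨?_, h0, h.trans (Real.rpow_le_one hc0 hc1 (by positivity))⟩
      rwa [one_div, Real.le_rpow_inv_iff_of_pos h0 hc0 hs] at h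
  rw [uniformPow_apply s measurableSet_Iic, hset, Real.volume_Icc, sub_zero]

theorem uniformPow_Icc_compl {s : ℝ} (hs : 0 < s) : uniformPow s (Set.Icc 0 1)ᶜ = 0 := by
  have hset : (fun u : ℝ => u ^ s) ⁻¹' (Set.Icc 0 1)ᶜ ∩ Set.Icc 0 1 = ∅ := by
    ext u
    simp only [Set.mem_inter_iff, Set.mem_preimage, Set.mem_compl_iff, Set.mem_Icc,
      Set.mem_empty_iff_false, iff_false, not_and, not_le]
    intro h h0
    by_contra! h1
    exact absurd (h (Real.rpow_nonneg h0 s)) (not_lt.2 (Real.rpow_le_one h0 h1 hs.le))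
  rw [uniformPow_apply s measurableSet_Icc.compl, hset, measure_empty]

theorem uniformPow_Iic_neg {s : ℝ} (hs : 0 < s) {c : ℝ} (hc : c < 0) :
    uniformPow s (Set.Iic c) = 0 := by
  refine measure_mono_null ?_ (uniformPow_Icc_compl hs)
  intro x hx h
  exact absurd (h.1.trans hx) (not_le.2 hc)

theorem nullSingletonClass_uniformPow {s : ℝ} (hs : 0 < s) :
    NullSingletonClass (uniformPow s) := by
  constructor
  intro c
  rw [uniformPow_apply s (measurableSet_singleton c)]
  refine measure_mono_null (t := {c ^ (1 / s)}) ?_ (by simp)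
  rintro u ⟨h, h0, -⟩
  simp only [Set.mem_preimage, Set.mem_singleton_iff] at h ⊢
  rw [← h, one_div, Real.rpow_rpow_inv h0 hs.ne']

/-- The joint law of the weight and the cost of an edge. -/
noncomputable def edgeLaw (s : ℝ) : Measure (ℝ × ℝ) := (uniformPow s).prod (uniformPow s)

instance isProbabilityMeasure_edgeLaw (s : ℝ) : IsProbabilityMeasure (edgeLaw s) := by
  unfold edgeLaw; infer_instance

/-- The volume of `{(x, y) ∈ [0, 1]² : x ^ s + y ^ s ≤ 1}`. -/
noncomputable def volConst (s : ℝ) : ℝ :=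
  Real.Gamma (1 / s + 1) ^ 2 / Real.Gamma (2 / s + 1)

theorem volConst_pos {s : ℝ} (hs : 0 < s) : 0 < volConst s :=
  div_pos (pow_pos (Real.Gamma_pos_of_pos (by positivity)) 2)
    (Real.Gamma_pos_of_pos (by positivity))

theorem integral_rpow_mul_one_sub_rpow {a b : ℝ} (ha : 0 < a) (hb : 0 < b) :
    ∫ x in (0 : ℝ)..1, x ^ (a - 1) * (1 - x) ^ (b - 1) = beta a b := by
  have h := beta_eq_betaIntegralReal a b ha hb
  rw [h, Complex.betaIntegral]
  have h2 : ∫ x in (0 : ℝ)..1, (x : ℂ) ^ ((a : ℂ) - 1) * (1 - (x : ℂ)) ^ ((b : ℂ) - 1)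
      = ∫ x in (0 : ℝ)..1, ((x ^ (a - 1) * (1 - x) ^ (b - 1) : ℝ) : ℂ) := by
    refine intervalIntegral.integral_congr fun x hx => ?_
    rw [Set.uIcc_of_le zero_le_one] at hx
    have hx_sub : 0 ≤ 1 - x := sub_nonneg.2 hx.2
    push_cast [Complex.ofReal_cpow hx.1, Complex.ofReal_cpow hx_sub]
    rfl
  rw [h2, intervalIntegral.integral_ofReal, Complex.ofReal_re]

/-- The substitution `x ↦ x ^ (1 / s)` turns the integral into `(1 / s) * beta (1 / s) (1 / s + 1)`.
-/
theorem integral_one_sub_rpow_rpow {s : ℝ} (hs : 0 < s) :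
    ∫ x in (0 : ℝ)..1, (1 - x ^ s) ^ (1 / s) = volConst s := by
  have hs' : 0 < 1 / s := by positivity
  have h1 := integral_comp_rpow_Ioi_of_pos
    (g := Set.indicator (Set.Ioc (0 : ℝ) 1) fun x : ℝ => (1 - x ^ s) ^ (1 / s)) hs'
  rw [setIntegral_indicator measurableSet_Ioc] at h1
  have hI : Set.Ioi (0 : ℝ) ∩ Set.Ioc 0 1 = Set.Ioc 0 1 := by
    ext x; simp +contextual
  rw [hI, ← intervalIntegral.integral_of_le zero_le_one] at h1
  rw [← h1]
  have h2 : ∫ x in Set.Ioi (0 : ℝ), (1 / s * x ^ (1 / s - 1)) •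
        Set.indicator (Set.Ioc (0 : ℝ) 1) (fun x : ℝ => (1 - x ^ s) ^ (1 / s)) (x ^ (1 / s))
      = ∫ x in Set.Ioi (0 : ℝ), Set.indicator (Set.Ioc (0 : ℝ) 1)
        (fun x => 1 / s * (x ^ (1 / s - 1) * (1 - x) ^ ((1 / s + 1) - 1))) x := by
    refine setIntegral_congr_fun measurableSet_Ioi fun x hx => ?_
    have hx0 : (0 : ℝ) < x := hx
    have hiff : x ^ (1 / s) ∈ Set.Ioc (0 : ℝ) 1 ↔ x ∈ Set.Ioc (0 : ℝ) 1 := by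
      simp only [Set.mem_Ioc, hx0, Real.rpow_pos_of_pos hx0, true_and]
      exact Real.rpow_le_one_iff_of_pos hx0 |>.trans (by constructor <;> intro h <;> grind)
    by_cases hx1 : x ∈ Set.Ioc (0 : ℝ) 1
    · simp only [Set.indicator_of_mem (hiff.2 hx1), Set.indicator_of_mem hx1]
      rw [one_div, Real.rpow_inv_rpow hx0.le hs.ne', smul_eq_mul, add_sub_cancel_right, mul_assoc]
    · simp only [Set.indicator_of_notMem (mt hiff.1 hx1), Set.indicator_of_notMem hx1, smul_zero]
  rw [h2, setIntegral_indicator measurableSet_Ioc, hI, integral_const_mul,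
    ← intervalIntegral.integral_of_le zero_le_one,
    integral_rpow_mul_one_sub_rpow hs' (by positivity), beta, volConst]
  have e : 1 / s + (1 / s + 1) = 2 / s + 1 := by ring
  rw [e, Real.Gamma_add_one hs'.ne']
  ring

/-- This is the area of `{u ^ s + l * v ^ s ≤ t}` in the unit square. Scaling the axes by `t ^ (1 /
s)` and `(t / l) ^ (1 / s)` reduces it to `volConst s`; the conditions `t ≤ 1` and `t ≤ l` ensure
that the square does not cut the region off. -/
theorem edgeLaw_le {s : ℝ} (hs : 0 < s) {l t : ℝ} (hl : 0 < l) (ht : 0 ≤ t) (ht1 : t ≤ 1)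
    (htl : t ≤ l) :
    edgeLaw s {p | p.1 + l * p.2 ≤ t} =
      ENNReal.ofReal (volConst s * (t ^ (2 / s) * l ^ (-(1 / s)))) := by
  have hs' : 0 < 1 / s := by positivity
  have hmeas : MeasurableSet {p : ℝ × ℝ | p.1 + l * p.2 ≤ t} :=
    measurableSet_le (by fun_prop) (by fun_prop)
  set τ : ℝ := t ^ (1 / s) with hτ
  have hτ0 : 0 ≤ τ := Real.rpow_nonneg ht _
  have hτ1 : τ ≤ 1 := Real.rpow_le_one ht ht1 hs'.le
  have hτs : τ ^ s = t := by rw [hτ, one_div, Real.rpow_inv_rpow ht hs.ne']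
  have hsec : ∀ w : ℝ, Prod.mk w ⁻¹' {p : ℝ × ℝ | p.1 + l * p.2 ≤ t} = Set.Iic ((t - w) / l) := by
    intro w
    ext c
    simp only [Set.mem_preimage, Set.mem_ofPred_eq, Set.mem_Iic, le_div_iff₀ hl]
    constructor <;> intro h <;> linarith
  have hmIic : Measurable fun w : ℝ => uniformPow s (Set.Iic ((t - w) / l)) := by
    simp_rw [← hsec]
    exact measurable_measure_prodMk_left hmeas
  rw [edgeLaw, Measure.prod_apply hmeas]
  simp_rw [hsec]
  have h0 : ∫⁻ w, uniformPow s (Set.Iic ((t - w) / l)) ∂uniformPow s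
      = ∫⁻ u in Set.Icc (0 : ℝ) 1, uniformPow s (Set.Iic ((t - u ^ s) / l)) := by
    conv_lhs => rw [uniformPow, ← uniformPow]
    exact lintegral_map hmIic (measurable_rpow_left s)
  rw [h0]
  have h1 : ∫⁻ u in Set.Icc (0 : ℝ) 1, uniformPow s (Set.Iic ((t - u ^ s) / l))
      = ∫⁻ u in Set.Icc (0 : ℝ) 1, Set.indicator (Set.Icc 0 τ)
        (fun u => ENNReal.ofReal (((t - u ^ s) / l) ^ (1 / s))) u := by
    refine setLIntegral_congr_fun measurableSet_Icc fun u hu => ?_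
    by_cases h : u ≤ τ
    · have hut : u ^ s ≤ t := by
        rw [← hτs]; exact Real.rpow_le_rpow hu.1 h hs.le
      have hu0 : 0 ≤ u ^ s := Real.rpow_nonneg hu.1 s
      rw [Set.indicator_of_mem (show u ∈ Set.Icc 0 τ from ⟨hu.1, h⟩),
        uniformPow_Iic hs (div_nonneg (by linarith) hl.le)]
      rw [div_le_one hl]; linarith
    · have hut : t < u ^ s := by
        rw [← hτs]; exact Real.rpow_lt_rpow hτ0 (not_le.1 h) hs
      rw [Set.indicator_of_notMem (fun hh => h hh.2),
        uniformPow_Iic_neg hs (div_neg_of_neg_of_pos (by linarith) hl)]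
  rw [h1, setLIntegral_indicator measurableSet_Icc,
    Set.inter_eq_left.2 (Set.Icc_subset_Icc_right hτ1)]
  have hcont : ContinuousOn (fun u : ℝ => ((t - u ^ s) / l) ^ (1 / s)) (Set.Icc 0 τ) := by
    refine ContinuousOn.rpow_const ?_ fun x _ => Or.inr hs'.le
    refine ((continuousOn_const.sub ?_)).div_const l
    exact continuousOn_id.rpow_const fun x _ => Or.inr hs.le
  rw [← ofReal_integral_eq_lintegral_ofReal hcont.integrableOn_Icc]
  · congr 1
    rw [integral_Icc_eq_integral_Ioc, ← intervalIntegral.integral_of_le hτ0]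
    have h3 := intervalIntegral.smul_integral_comp_mul_left
      (a := 0) (b := 1) (fun u : ℝ => ((t - u ^ s) / l) ^ (1 / s)) τ
    rw [mul_zero, mul_one] at h3
    rw [← h3]
    have h4 : ∫ x in (0 : ℝ)..1, ((t - (τ * x) ^ s) / l) ^ (1 / s)
        = ∫ x in (0 : ℝ)..1, (τ * l ^ (-(1 / s))) * (1 - x ^ s) ^ (1 / s) := by
      refine intervalIntegral.integral_congr fun x hx => ?_
      rw [Set.uIcc_of_le zero_le_one] at hx
      have hx1 : 0 ≤ 1 - x ^ s := sub_nonneg.2 (Real.rpow_le_one hx.1 hx.2 hs.le)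
      rw [Real.mul_rpow hτ0 hx.1, hτs, show (t - t * x ^ s) / l = t * l⁻¹ * (1 - x ^ s) by
        field_simp, Real.mul_rpow (by positivity) hx1, Real.mul_rpow ht (by positivity),
        Real.inv_rpow hl.le, Real.rpow_neg hl.le]
    rw [h4, intervalIntegral.integral_const_mul, integral_one_sub_rpow_rpow hs, smul_eq_mul]
    have h5 : t ^ (2 / s) = τ * τ := by
      rw [hτ, ← Real.rpow_add_of_nonneg ht hs'.le hs'.le]; congr 1; ring
    rw [h5]; ring
  · refine (ae_restrict_iff' measurableSet_Icc).2 (Eventually.of_forall fun u hu => ?_)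
    have hut : u ^ s ≤ t := by
      rw [← hτs]; exact Real.rpow_le_rpow hu.1 hu.2 hs.le
    exact Real.rpow_nonneg (div_nonneg (by linarith) hl.le) _

theorem edgeLaw_prod_tie {s : ℝ} (hs : 0 < s) (l : ℝ) (x : ℝ) :
    edgeLaw s {p | p.1 + l * p.2 = x} = 0 := by
  have := nullSingletonClass_uniformPow hs
  have hmeas : MeasurableSet {p : ℝ × ℝ | p.1 + l * p.2 = x} :=
    measurableSet_eq_fun (by fun_prop) (by fun_prop)
  rw [edgeLaw, Measure.prod_apply_symm hmeas]
  simp only [lintegral_eq_zero_iff' (measurable_measure_prodMk_right hmeas).aemeasurable]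
  refine Eventually.of_forall fun c => ?_
  have : (fun w : ℝ => (w, c)) ⁻¹' {p : ℝ × ℝ | p.1 + l * p.2 = x} = {x - l * c} := by
    ext w
    simp [eq_sub_iff_add_eq]
  simp only [this, Pi.zero_apply]
  exact measure_singleton _

theorem edgeLaw_ae_mem (s : ℝ) (hs : 0 < s) :
    ∀ᵐ p ∂edgeLaw s, p.1 ∈ Set.Icc (0 : ℝ) 1 ∧ p.2 ∈ Set.Icc (0 : ℝ) 1 := by
  have h : ∀ᵐ x ∂uniformPow s, x ∈ Set.Icc (0 : ℝ) 1 := uniformPow_Icc_compl hs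
  have h1 := (Measure.quasiMeasurePreserving_fst (μ := uniformPow s) (ν := uniformPow s)).ae h
  have h2 := (Measure.quasiMeasurePreserving_snd (μ := uniformPow s) (ν := uniformPow s)).ae h
  exact h1.and h2

theorem Cs_eq {s : ℝ} (hs : 0 < s) :
    Cs s = volConst s ^ (-(s / 2)) * Real.Gamma (s / 2 + 1) := by
  have h1 : 0 < Real.Gamma (1 / s + 1) := Real.Gamma_pos_of_pos (by positivity)
  have h2 : 0 < Real.Gamma (2 / s + 1) := Real.Gamma_pos_of_pos (by positivity)
  rw [Cs, volConst, Real.rpow_neg (by positivity), ← Real.inv_rpow (by positivity), inv_div]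
  ring

theorem Cs_pos {s : ℝ} (hs : 0 < s) : 0 < Cs s := by
  rw [Cs_eq hs]
  exact mul_pos (Real.rpow_pos_of_pos (volConst_pos hs) _) (Real.Gamma_pos_of_pos (by positivity))

/-! ### The best edge into one vertex. -/

/-- The law of the weights and costs of the edges into one vertex. -/
noncomputable def blockLaw (s : ℝ) (ι : Type*) [Fintype ι] : Measure (ι → ℝ × ℝ) :=
  Measure.pi fun _ => edgeLaw s

instance isProbabilityMeasure_blockLaw (s : ℝ) (ι : Type*) [Fintype ι] :
    IsProbabilityMeasure (blockLaw s ι) := by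
  unfold blockLaw; infer_instance

/-- The least value of `weight + l * cost` over the edges into one vertex. -/
noncomputable def blockMin (l : ℝ) {ι : Type*} (x : ι → ℝ × ℝ) : ℝ :=
  ⨅ i, ((x i).1 + l * (x i).2)

section Block

variable {ι : Type*} [Fintype ι]

theorem measurable_blockMin (l : ℝ) : Measurable (blockMin l : (ι → ℝ × ℝ) → ℝ) := by
  unfold blockMin
  exact Measurable.iInf fun i => by fun_prop

theorem blockMin_le (l : ℝ) (x : ι → ℝ × ℝ) (i : ι) : blockMin l x ≤ (x i).1 + l * (x i).2 :=
  ciInf_le (Set.finite_range _).bddBelow i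

theorem exists_eq_blockMin [Nonempty ι] (l : ℝ) (x : ι → ℝ × ℝ) :
    ∃ i, (x i).1 + l * (x i).2 = blockMin l x :=
  exists_eq_ciInf_of_finite

theorem lt_blockMin_iff [Nonempty ι] (l t : ℝ) (x : ι → ℝ × ℝ) :
    t < blockMin l x ↔ ∀ i, t < (x i).1 + l * (x i).2 := by
  constructor
  · exact fun h i => h.trans_le (blockMin_le l x i)
  · intro h
    obtain ⟨i, hi⟩ := exists_eq_blockMin l x
    exact hi ▸ h i

theorem blockMin_nonneg_ae [Nonempty ι] {s l : ℝ} (hs : 0 < s) (hl : 0 ≤ l) :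
    ∀ᵐ x ∂blockLaw s ι, 0 ≤ blockMin l x := by
  have h : ∀ᵐ x ∂blockLaw s ι, ∀ i, (x i).1 ∈ Set.Icc (0 : ℝ) 1 ∧ (x i).2 ∈ Set.Icc (0 : ℝ) 1 := by
    rw [ae_all_iff]
    intro i
    exact (Measure.quasiMeasurePreserving_eval (fun _ : ι => edgeLaw s) i).ae (edgeLaw_ae_mem s hs)
  filter_upwards [h] with x hx
  obtain ⟨i, hi⟩ := exists_eq_blockMin l x
  rw [← hi]
  exact add_nonneg (hx i).1.1 (mul_nonneg hl (hx i).2.1)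

theorem blockLaw_lt_blockMin [Nonempty ι] {s : ℝ} (hs : 0 < s) {l t : ℝ} (hl : 0 < l)
    (ht : 0 ≤ t) (ht1 : t ≤ 1) (htl : t ≤ l) :
    (blockLaw s ι).real {x | t < blockMin l x} =
      (1 - volConst s * (t ^ (2 / s) * l ^ (-(1 / s)))) ^ Fintype.card ι := by
  have hm : MeasurableSet {p : ℝ × ℝ | p.1 + l * p.2 ≤ t} :=
    measurableSet_le (by fun_prop) (by fun_prop)
  have h0 : 0 ≤ volConst s * (t ^ (2 / s) * l ^ (-(1 / s))) :=
    mul_nonneg (volConst_pos hs).le (by positivity)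
  have h1 : (edgeLaw s).real {p | t < p.1 + l * p.2} =
      1 - volConst s * (t ^ (2 / s) * l ^ (-(1 / s))) := by
    have hc : {p : ℝ × ℝ | t < p.1 + l * p.2} = {p : ℝ × ℝ | p.1 + l * p.2 ≤ t}ᶜ := by
      ext p; simp
    rw [hc, measureReal_compl hm, probReal_univ, Measure.real, edgeLaw_le hs hl ht ht1 htl,
      ENNReal.toReal_ofReal h0]
  have h2 : {x : ι → ℝ × ℝ | t < blockMin l x} =
      Set.pi Set.univ fun _ => {p : ℝ × ℝ | t < p.1 + l * p.2} := by
    ext x; simp [lt_blockMin_iff]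
  rw [h2, Measure.real, blockLaw, Measure.pi_pi, ENNReal.toReal_prod]
  change ∏ i : ι, (edgeLaw s).real {p | t < p.1 + l * p.2} = _
  rw [h1, Finset.prod_const, Finset.card_univ]

/-- The left side is a probability. The bound makes the base of `scaledTail` nonnegative. -/
theorem volConst_mul_le_one {s : ℝ} (hs : 0 < s) {l t : ℝ} (hl : 0 < l)
    (ht : 0 ≤ t) (ht1 : t ≤ 1) (htl : t ≤ l) :
    volConst s * (t ^ (2 / s) * l ^ (-(1 / s))) ≤ 1 := by
  have h := edgeLaw_le hs hl ht ht1 htl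
  have h1 : ENNReal.ofReal (volConst s * (t ^ (2 / s) * l ^ (-(1 / s)))) ≤ 1 := h ▸ prob_le_one
  simpa using h1

/-- An edge is at least as good as every other edge with the same head with probability at most
the inverse of the number of competitors. -/
theorem blockLaw_minimizer_le {s : ℝ} (hs : 0 < s) (l : ℝ) (i : ι) :
    blockLaw s ι {x | ∀ j, (x i).1 + l * (x i).2 ≤ (x j).1 + l * (x j).2} ≤
      (Fintype.card ι : ENNReal)⁻¹ := by
  classical
  set A : ι → Set (ι → ℝ × ℝ) := fun i => {x | ∀ j, (x i).1 + l * (x i).2 ≤ (x j).1 + l * (x j).2}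
    with hA
  have hAm : ∀ i, MeasurableSet (A i) := by
    intro i
    simp only [hA, Set.ofPred_forall]
    exact MeasurableSet.iInter fun j => measurableSet_le (by fun_prop) (by fun_prop)
  -- Exchangeability: swapping two coordinates preserves the product law.
  have hsymm : ∀ i', blockLaw s ι (A i') = blockLaw s ι (A i) := by
    intro i'
    have hp := measurePreserving_piCongrLeft (fun _ : ι => edgeLaw s) (Equiv.swap i i')
    have h := hp.measure_preimage (hAm i).nullMeasurableSet
    have hset : (MeasurableEquiv.piCongrLeft (fun _ : ι => ℝ × ℝ) (Equiv.swap i i')) ⁻¹' A i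
        = A i' := by
      ext x
      have hx : ∀ j, (MeasurableEquiv.piCongrLeft (fun _ : ι => ℝ × ℝ) (Equiv.swap i i')) x j
          = x (Equiv.swap i i' j) := by
        intro j
        have := MeasurableEquiv.piCongrLeft_apply_apply (Equiv.swap i i') (β := fun _ => ℝ × ℝ) x
          (Equiv.swap i i' j)
        rwa [Equiv.swap_apply_self] at this
      simp only [hA, Set.mem_preimage, Set.mem_ofPred_eq, hx, Equiv.swap_apply_left]
      exact (Equiv.swap i i').forall_congr_right (q := fun j =>
        (x i').1 + l * (x i').2 ≤ (x j).1 + l * (x j).2)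
    rw [hset] at h
    exact h
  -- Ties are null, so these equiprobable events are almost disjoint and their probabilities sum to
  -- at most 1.
  have htie : Pairwise (Function.onFun (AEDisjoint (blockLaw s ι)) A) := by
    intro a b hab
    have hsub : A a ∩ A b ⊆ {x | (x a).1 + l * (x a).2 = (x b).1 + l * (x b).2} :=
      fun x hx => le_antisymm (hx.1 b) (hx.2 a)
    refine measure_mono_null hsub ?_
    have hind : IndepFun (fun x : ι → ℝ × ℝ => x a) (fun x => x b) (blockLaw s ι) :=
      (iIndepFun_pi (μ := fun _ : ι => edgeLaw s) (X := fun _ x => x)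
        fun _ => aemeasurable_id).indepFun hab
    have hlaw : ∀ c, (blockLaw s ι).map (fun x => x c) = edgeLaw s :=
      fun c => (measurePreserving_eval (fun _ : ι => edgeLaw s) c).map_eq
    have hprod := (indepFun_iff_map_prod_eq_prod_map_map (measurable_pi_apply a).aemeasurable
      (measurable_pi_apply b).aemeasurable).1 hind
    rw [hlaw, hlaw] at hprod
    have hm : MeasurableSet {p : (ℝ × ℝ) × ℝ × ℝ | p.1.1 + l * p.1.2 = p.2.1 + l * p.2.2} :=
      measurableSet_eq_fun (by fun_prop) (by fun_prop)
    have h0 : (blockLaw s ι).map (fun x => (x a, x b))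
        {p : (ℝ × ℝ) × ℝ × ℝ | p.1.1 + l * p.1.2 = p.2.1 + l * p.2.2} = 0 := by
      rw [hprod, Measure.prod_apply_symm hm]
      simp only [lintegral_eq_zero_iff' (measurable_measure_prodMk_right hm).aemeasurable]
      exact Eventually.of_forall fun c => edgeLaw_prod_tie hs l (c.1 + l * c.2)
    rwa [Measure.map_apply (by fun_prop) hm] at h0
  have hsum : ∑ j, blockLaw s ι (A j) ≤ 1 := by
    have h := measure_iUnion₀ htie fun j => (hAm j).nullMeasurableSet
    rw [tsum_fintype] at h
    rw [← h]
    exact prob_le_one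
  simp_rw [hsymm, Finset.sum_const, Finset.card_univ, nsmul_eq_mul] at hsum
  exact ENNReal.le_inv_iff_mul_le.2 (by rwa [mul_comm])

/-! ### Tail, mean and variance of the rescaled minimum. -/

/-- The truncated and rescaled least value over the edges into one vertex, for `n` vertices. -/
noncomputable def scaledMin (s l : ℝ) (n : ℕ) (x : ι → ℝ × ℝ) : ℝ :=
  min (blockMin l x) (min 1 l) / (√l * (n : ℝ) ^ (-(s / 2)))

/-- The largest possible value of `scaledMin`. -/
noncomputable def scaledMax (s l : ℝ) (n : ℕ) : ℝ := min 1 l / (√l * (n : ℝ) ^ (-(s / 2)))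

theorem measurable_scaledMin (s l : ℝ) (n : ℕ) :
    Measurable (scaledMin s l n : (ι → ℝ × ℝ) → ℝ) :=
  ((measurable_blockMin l).min measurable_const).div_const _

theorem scaledMin_mem_ae [Nonempty ι] {s l : ℝ} (hs : 0 < s) (hl : 0 < l) (n : ℕ) :
    ∀ᵐ x ∂blockLaw s ι, scaledMin s l n x ∈ Set.Icc 0 (scaledMax s l n) := by
  filter_upwards [blockMin_nonneg_ae hs hl.le] with x hx
  have h : 0 ≤ √l * (n : ℝ) ^ (-(s / 2)) := by positivity
  exact ⟨div_nonneg (le_min hx (le_min zero_le_one hl.le)) h,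
    div_le_div_of_nonneg_right (min_le_right _ _) h⟩

/-- The tail of `scaledMin`. -/
noncomputable def scaledTail (s : ℝ) (n : ℕ) (y : ℝ) : ℝ :=
  (1 - volConst s * y ^ (2 / s) / n) ^ (n - 1)

theorem scaled_eq {s : ℝ} (hs : 0 < s) {l y : ℝ} (hl : 0 < l) {n : ℕ} (hn : 0 < n) (hy : 0 ≤ y) :
    volConst s * ((y * (√l * (n : ℝ) ^ (-(s / 2)))) ^ (2 / s) * l ^ (-(1 / s))) =
      volConst s * y ^ (2 / s) / n := by
  have hn' : (0 : ℝ) < n := by exact_mod_cast hn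
  rw [Real.mul_rpow hy (by positivity), Real.mul_rpow (by positivity) (by positivity),
    Real.sqrt_eq_rpow, ← Real.rpow_mul hl.le, ← Real.rpow_mul hn'.le]
  have e1 : 1 / 2 * (2 / s) = 1 / s := by ring
  have e2 : -(s / 2) * (2 / s) = -1 := by field_simp
  rw [e1, e2, Real.rpow_neg_one, Real.rpow_neg hl.le]
  have : 0 < l ^ (1 / s) := Real.rpow_pos_of_pos hl _
  field_simp

theorem blockLaw_lt_blockMin_scaled [Nonempty ι] {s : ℝ} (hs : 0 < s) {l y : ℝ} (hl : 0 < l)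
    {n : ℕ} (hn : 0 < n) (hι : Fintype.card ι = n - 1) (hy : 0 ≤ y) (hyR : y ≤ scaledMax s l n) :
    (blockLaw s ι).real {x | y * (√l * (n : ℝ) ^ (-(s / 2))) < blockMin l x} = scaledTail s n y ∧
      volConst s * y ^ (2 / s) / n ≤ 1 := by
  have hn' : (0 : ℝ) < n := by exact_mod_cast hn
  have ha : 0 < √l * (n : ℝ) ^ (-(s / 2)) := by positivity
  rw [scaledMax, le_div_iff₀ ha] at hyR
  have h1 := hyR.trans (min_le_left _ _)
  have h2 := hyR.trans (min_le_right _ _)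
  have h0 : 0 ≤ y * (√l * (n : ℝ) ^ (-(s / 2))) := by positivity
  refine ⟨?_, ?_⟩
  · rw [blockLaw_lt_blockMin hs hl h0 h1 h2, scaled_eq hs hl hn hy, hι, scaledTail]
  · rw [← scaled_eq hs hl hn hy]
    exact volConst_mul_le_one hs hl h0 h1 h2

/-- Truncating at `min 1 l` confines the variable to the range where `edgeLaw_le` is exact, so the
tail formula holds for every `y ≥ 0`. -/
theorem blockLaw_lt_scaledMin [Nonempty ι] {s : ℝ} (hs : 0 < s) {l y : ℝ} (hl : 0 < l)
    {n : ℕ} (hn : 0 < n) (hι : Fintype.card ι = n - 1) (hy : 0 ≤ y) :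
    (blockLaw s ι).real {x | y < scaledMin s l n x} =
      Set.indicator (Set.Iio (scaledMax s l n)) (scaledTail s n) y := by
  have hn' : (0 : ℝ) < n := by exact_mod_cast hn
  have ha : 0 < √l * (n : ℝ) ^ (-(s / 2)) := by positivity
  by_cases h : y < scaledMax s l n
  · rw [Set.indicator_of_mem (show y ∈ Set.Iio _ from h),
      ← (blockLaw_lt_blockMin_scaled hs hl hn hι hy h.le).1]
    congr 1
    ext x
    rw [scaledMax, lt_div_iff₀ ha] at h
    simp only [Set.mem_ofPred_eq, scaledMin, lt_div_iff₀ ha, lt_min_iff]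
    exact ⟨fun h => h.1, fun h' => ⟨h', lt_min_iff.1 h⟩⟩
  · rw [Set.indicator_of_notMem (show y ∉ Set.Iio _ from h)]
    have : {x : ι → ℝ × ℝ | y < scaledMin s l n x} = ∅ := by
      ext x
      simp only [Set.mem_ofPred_eq, Set.mem_empty_iff_false, iff_false, not_lt]
      exact le_trans (div_le_div_of_nonneg_right (min_le_right _ _) ha.le) (not_lt.1 h)
    simp [this]

theorem memLp_scaledMin [Nonempty ι] {s l : ℝ} (hs : 0 < s) (hl : 0 < l) (n : ℕ) :
    MemLp (scaledMin s l n) 2 (blockLaw s ι) :=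
  memLp_of_bounded (scaledMin_mem_ae hs hl n) (measurable_scaledMin s l n).aestronglyMeasurable 2

theorem integral_scaledMin [Nonempty ι] {s : ℝ} (hs : 0 < s) {l : ℝ} (hl : 0 < l)
    {n : ℕ} (hn : 0 < n) (hι : Fintype.card ι = n - 1) :
    ∫ x, scaledMin s l n x ∂blockLaw s ι =
      ∫ y in Set.Ioi 0, Set.indicator (Set.Iio (scaledMax s l n)) (scaledTail s n) y := by
  rw [((memLp_scaledMin hs hl n).integrable one_le_two).integral_eq_integral_meas_lt
    ((scaledMin_mem_ae hs hl n).mono fun x hx => hx.1)]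
  exact setIntegral_congr_fun measurableSet_Ioi fun y hy =>
    blockLaw_lt_scaledMin hs hl hn hι (le_of_lt hy)

theorem indicator_scaledTail_nonneg {s : ℝ} {n : ℕ} {R : ℝ}
    (hR : ∀ y, 0 ≤ y → y ≤ R → volConst s * y ^ (2 / s) / n ≤ 1) {y : ℝ} (hy : 0 ≤ y) :
    0 ≤ Set.indicator (Set.Iio R) (scaledTail s n) y := by
  by_cases h : y ∈ Set.Iio R
  · rw [Set.indicator_of_mem h]
    exact pow_nonneg (sub_nonneg.2 (hR y hy (le_of_lt h))) _
  · rw [Set.indicator_of_notMem h]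

/-- Use `1 - a ≤ exp (-a)` and `(n - 1) / n ≥ 1 / 2`. Halving the constant in the exponent makes the
bound independent of `n`, so it dominates both the mean and the second moment. -/
theorem scaledTail_le {s : ℝ} (hs : 0 < s) {n : ℕ} (hn : 2 ≤ n) {y : ℝ} (hy : 0 ≤ y)
    (h : volConst s * y ^ (2 / s) / n ≤ 1) :
    scaledTail s n y ≤ Real.exp (-(volConst s / 2) * y ^ (2 / s)) := by
  have hn' : (2 : ℝ) ≤ n := by exact_mod_cast hn
  have hv := (volConst_pos hs).le
  have hy' : 0 ≤ y ^ (2 / s) := Real.rpow_nonneg hy _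
  calc scaledTail s n y ≤ Real.exp (-(volConst s * y ^ (2 / s) / n)) ^ (n - 1) := by
        refine pow_le_pow_left₀ (sub_nonneg.2 h) ?_ _
        have := Real.add_one_le_exp (-(volConst s * y ^ (2 / s) / n))
        linarith
    _ = Real.exp (((n - 1 : ℕ) : ℝ) * -(volConst s * y ^ (2 / s) / n)) := by rw [Real.exp_nat_mul]
    _ ≤ _ := by
        refine Real.exp_le_exp.2 ?_
        rw [Nat.cast_sub (by omega), Nat.cast_one]
        have h1 : (1 / 2 : ℝ) ≤ (n - 1) / n := by
          rw [div_le_div_iff₀ two_pos (by linarith)]; linarith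
        have h2 := mul_le_mul_of_nonneg_left h1 (mul_nonneg hv hy')
        have h3 : ((n : ℝ) - 1) * -(volConst s * y ^ (2 / s) / n)
          = -(volConst s * y ^ (2 / s) * ((n - 1) / n)) := by ring
        rw [h3]
        linarith

theorem indicator_scaledTail_le {s : ℝ} (hs : 0 < s) {n : ℕ} (hn : 2 ≤ n) {R : ℝ}
    (hR : ∀ y, 0 ≤ y → y ≤ R → volConst s * y ^ (2 / s) / n ≤ 1) {y : ℝ} (hy : 0 ≤ y) :
    Set.indicator (Set.Iio R) (scaledTail s n) y ≤
      Real.exp (-(volConst s / 2) * y ^ (2 / s)) := by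
  by_cases h : y ∈ Set.Iio R
  · rw [Set.indicator_of_mem h]
    exact scaledTail_le hs hn hy (hR y hy (le_of_lt h))
  · rw [Set.indicator_of_notMem h]
    exact (Real.exp_pos _).le

theorem integrableOn_exp_neg_mul_rpow {p b : ℝ} (hp : 0 < p) (hb : 0 < b) :
    IntegrableOn (fun y : ℝ => Real.exp (-b * y ^ p)) (Set.Ioi 0) := by
  simpa using integrableOn_rpow_mul_exp_neg_mul_rpow (s := 0) (by norm_num) hp hb

theorem tendsto_scaledTail (s : ℝ) (y : ℝ) :
    Tendsto (fun n => scaledTail s n y) atTop (𝓝 (Real.exp (-volConst s * y ^ (2 / s)))) := by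
  have h1 := Real.tendsto_one_add_div_pow_exp (-(volConst s * y ^ (2 / s)))
  have h2 : Tendsto (fun n : ℕ => 1 + -(volConst s * y ^ (2 / s)) / (n : ℝ)) atTop (𝓝 1) := by
    simpa using (tendsto_const_div_atTop_nhds_zero_nat (-(volConst s * y ^ (2 / s)))).const_add 1
  -- The exponent is `n - 1` rather than `n`; the extra factor tends to 1.
  have h3 := h1.div h2 one_ne_zero
  rw [div_one] at h3
  rw [neg_mul]
  refine h3.congr' ?_
  filter_upwards [h2.eventually_ne one_ne_zero, eventually_ge_atTop 1] with n hn hn1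
  have e : 1 - volConst s * y ^ (2 / s) / n = 1 + -(volConst s * y ^ (2 / s)) / (n : ℝ) := by ring
  rw [scaledTail, e, Pi.div_apply, div_eq_iff hn, ← pow_succ, Nat.sub_add_cancel hn1]

theorem tendsto_integral_scaledTail {s : ℝ} (hs : 0 < s) {R : ℕ → ℝ} (hRtop : Tendsto R atTop atTop)
    (hR : ∀ᶠ n : ℕ in atTop, ∀ y, 0 ≤ y → y ≤ R n → volConst s * y ^ (2 / s) / n ≤ 1) :
    Tendsto (fun n => ∫ y in Set.Ioi 0, Set.indicator (Set.Iio (R n)) (scaledTail s n) y)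
      atTop (𝓝 (Cs s)) := by
  have hlim : Cs s = ∫ y in Set.Ioi 0, Real.exp (-volConst s * y ^ (2 / s)) := by
    rw [integral_exp_neg_mul_rpow (by positivity) (volConst_pos hs), Cs_eq hs]
    congr 2
    · field_simp
    · field_simp
  rw [hlim]
  refine tendsto_integral_filter_of_dominated_convergence
    (fun y => Real.exp (-(volConst s / 2) * y ^ (2 / s))) ?_ ?_
    (integrableOn_exp_neg_mul_rpow (by positivity) (half_pos (volConst_pos hs))) ?_
  · refine Eventually.of_forall fun n => (Measurable.indicator ?_ measurableSet_Iio).aestronglyMeasurable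
    unfold scaledTail
    fun_prop
  · filter_upwards [hR, eventually_ge_atTop 2] with n hn hn2
    refine (ae_restrict_iff' measurableSet_Ioi).2 (Eventually.of_forall fun y hy => ?_)
    rw [Real.norm_of_nonneg (indicator_scaledTail_nonneg hn (le_of_lt hy))]
    exact indicator_scaledTail_le hs hn2 hn (le_of_lt hy)
  · refine Eventually.of_forall fun y => (tendsto_scaledTail s y).congr' ?_
    filter_upwards [hRtop.eventually_gt_atTop y] with n hn
    rw [Set.indicator_of_mem (show y ∈ Set.Iio _ from hn)]

/-- A bound on the second moment of `scaledMin`. -/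
noncomputable def secondMomentBound (s : ℝ) : ℝ :=
  ∫ t in Set.Ioi (0 : ℝ), Real.exp (-(volConst s / 2) * t ^ (1 / s))

theorem variance_scaledMin_le [Nonempty ι] {s : ℝ} (hs : 0 < s) {l : ℝ} (hl : 0 < l)
    {n : ℕ} (hn : 2 ≤ n) (hι : Fintype.card ι = n - 1) :
    Var[scaledMin s l n; blockLaw s ι] ≤ secondMomentBound s := by
  have hLp := memLp_scaledMin (ι := ι) hs hl n
  refine (variance_le_expectation_sq hLp.aestronglyMeasurable).trans ?_
  have hint : Integrable (fun x : ι → ℝ × ℝ => scaledMin s l n x ^ 2) (blockLaw s ι) :=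
    hLp.integrable_sq
  change ∫ x, scaledMin s l n x ^ 2 ∂blockLaw s ι ≤ _
  rw [hint.integral_eq_integral_meas_lt (Eventually.of_forall fun x => sq_nonneg _)]
  refine integral_mono_of_nonneg (Eventually.of_forall fun t => measureReal_nonneg)
    (integrableOn_exp_neg_mul_rpow (by positivity) (half_pos (volConst_pos hs))) ?_
  refine (ae_restrict_iff' measurableSet_Ioi).2 (Eventually.of_forall fun t ht => ?_)
  have ht0 : (0 : ℝ) < t := ht
  -- Passing to `√t` in the layer-cake formula turns the exponent `2 / s` into `1 / s`.
  have h1 : (blockLaw s ι).real {x | t < scaledMin s l n x ^ 2} ≤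
      (blockLaw s ι).real {x | √t < scaledMin s l n x} := by
    refine ENNReal.toReal_mono (measure_ne_top _ _) (measure_mono_ae ?_)
    filter_upwards [scaledMin_mem_ae hs hl n] with x hx h
    exact (Real.sqrt_lt' (lt_of_le_of_ne hx.1 (by
      rintro h0
      have h' : t < scaledMin s l n x ^ 2 := h
      rw [← h0] at h'
      norm_num at h'
      linarith))).2 h
  refine h1.trans ?_
  rw [blockLaw_lt_scaledMin hs hl (by omega) hι (Real.sqrt_nonneg t)]
  refine (indicator_scaledTail_le hs hn (fun y hy hyR =>
    (blockLaw_lt_blockMin_scaled (ι := ι) hs hl (by omega) hι hy hyR).2)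
      (Real.sqrt_nonneg t)).trans_eq ?_
  rw [Real.sqrt_eq_rpow, ← Real.rpow_mul ht0.le]
  congr 3
  ring

end Block

/-! ### Concentration of the Lagrangian sum. -/

/-- The weights and costs of all the edges, grouped by the head of the edge. -/
abbrev InBlocks (n : ℕ) : Type := (v : Fin n) → {u : Fin n // u ≠ v} → ℝ × ℝ

/-- The law of the weights and costs, grouped by the head of the edge. -/
noncomputable def modelLaw (s : ℝ) (n : ℕ) : Measure (InBlocks n) :=
  Measure.pi fun v => blockLaw s {u : Fin n // u ≠ v}

instance isProbabilityMeasure_modelLaw (s : ℝ) (n : ℕ) : IsProbabilityMeasure (modelLaw s n) := by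
  unfold modelLaw; infer_instance

theorem card_ne {n : ℕ} (v : Fin n) : Fintype.card {u : Fin n // u ≠ v} = n - 1 := by
  simp [Fintype.card_subtype_compl]

theorem nonempty_ne {n : ℕ} (hn : 2 ≤ n) (v : Fin n) : Nonempty {u : Fin n // u ≠ v} := by
  rw [← Fintype.card_pos_iff, card_ne]; omega

/-- The sum over all vertices of the least value of `weight + l * cost` over the incoming edges. -/
noncomputable def lagrangeSum (l : ℝ) {n : ℕ} (ω : InBlocks n) : ℝ := ∑ v, blockMin l (ω v)

theorem modelLaw_eval_preimage (s : ℝ) {n : ℕ} (v : Fin n)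
    {A : Set ({u : Fin n // u ≠ v} → ℝ × ℝ)} (hA : MeasurableSet A) :
    modelLaw s n {ω | ω v ∈ A} = blockLaw s {u : Fin n // u ≠ v} A :=
  (measurePreserving_eval (fun v : Fin n => blockLaw s {u : Fin n // u ≠ v}) v).measure_preimage
    hA.nullMeasurableSet

/-- The mean of `scaledMin`. -/
noncomputable def scaledMean (s l : ℝ) (n : ℕ) : ℝ :=
  ∫ y in Set.Ioi 0, Set.indicator (Set.Iio (scaledMax s l n)) (scaledTail s n) y

/-- Chebyshev's inequality: the blocks of different heads are independent, so the variance of the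
sum is linear in `n`. -/
theorem modelLaw_deviation_le {s : ℝ} (hs : 0 < s) {l : ℝ} (hl : 0 < l) {n : ℕ} (hn : 2 ≤ n)
    {κ : ℝ} (hκ : 0 < κ) :
    modelLaw s n {ω | κ * n ≤ |∑ v, scaledMin s l n (ω v) - n * scaledMean s l n|} ≤
      ENNReal.ofReal (secondMomentBound s / κ ^ 2 / n) := by
  have hn' : (0 : ℝ) < n := by exact_mod_cast (by omega : 0 < n)
  have hne := fun v => nonempty_ne hn v
  have hLp : ∀ v : Fin n, MemLp (scaledMin s l n) 2 (blockLaw s {u : Fin n // u ≠ v}) :=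
    fun v => memLp_scaledMin hs hl n
  have hLp' : ∀ v : Fin n, MemLp (fun ω : InBlocks n => scaledMin s l n (ω v)) 2 (modelLaw s n) :=
    fun v => (hLp v).comp_measurePreserving
      (measurePreserving_eval (fun v : Fin n => blockLaw s {u : Fin n // u ≠ v}) v)
  have hmean : ∀ v : Fin n, ∫ ω, scaledMin s l n (ω v) ∂modelLaw s n = scaledMean s l n := by
    intro v
    rw [scaledMean, ← integral_scaledMin (ι := {u : Fin n // u ≠ v}) hs hl (by omega) (card_ne v)]
    exact integral_comp_eval (μ := fun v : Fin n => blockLaw s {u : Fin n // u ≠ v})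
      (measurable_scaledMin s l n).aestronglyMeasurable
  have hvar : Var[∑ v, fun ω : InBlocks n => scaledMin s l n (ω v); modelLaw s n] ≤
      n * secondMomentBound s := by
    rw [modelLaw, variance_sum_pi hLp]
    refine (Finset.sum_le_sum fun v _ => variance_scaledMin_le hs hl hn (card_ne v)).trans_eq ?_
    simp
  have hSum : MemLp (∑ v, fun ω : InBlocks n => scaledMin s l n (ω v)) 2 (modelLaw s n) :=
    memLp_finsetSum' _ fun v _ => hLp' v
  have hE : ∫ ω, (∑ v, fun ω : InBlocks n => scaledMin s l n (ω v)) ω ∂modelLaw s n =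
      n * scaledMean s l n := by
    simp only [Finset.sum_apply]
    rw [integral_finsetSum _ fun v _ => (hLp' v).integrable one_le_two]
    simp [hmean]
  have h := meas_ge_le_variance_div_sq hSum (mul_pos hκ hn')
  rw [hE] at h
  simp only [Finset.sum_apply] at h
  refine h.trans (ENNReal.ofReal_le_ofReal ?_)
  rw [div_div, div_le_div_iff₀ (by positivity) (by positivity)]
  calc _ ≤ n * secondMomentBound s * (κ ^ 2 * n) := by gcongr
    _ = _ := by ring

/-- After squaring, `h2` handles the truncation at 1 and `h1` the truncation at `l`. This is where
the logarithms in the range of `c₀` are needed: the truncation level must exceed the largest of `n`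
minima. -/
theorem eventually_le_scaledMax {s : ℝ} {l : ℕ → ℝ} (hl : ∀ᶠ n in atTop, 0 < l n)
    (h1 : Tendsto (fun n : ℕ => l n * ((n : ℝ) / Real.log n) ^ s) atTop atTop)
    (h2 : Tendsto (fun n : ℕ => ((n : ℝ) / Real.log n) ^ s / l n) atTop atTop)
    {c : ℝ} (hc : 0 < c) :
    ∀ᶠ n : ℕ in atTop, (c * Real.log n) ^ (s / 2) ≤ scaledMax s (l n) n := by
  filter_upwards [hl, h1.eventually_ge_atTop (c ^ s), h2.eventually_ge_atTop (c ^ s),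
    eventually_ge_atTop 2] with n hl h1 h2 hn
  have hn' : (1 : ℝ) < n := by exact_mod_cast hn
  have hlog := Real.log_pos hn'
  have hn0 : (0 : ℝ) < n := by linarith
  have hns : 0 < (n : ℝ) ^ s := Real.rpow_pos_of_pos hn0 s
  have hls : 0 < (Real.log n) ^ s := Real.rpow_pos_of_pos hlog s
  rw [Real.div_rpow hn0.le hlog.le] at h1 h2
  rw [mul_div_assoc', le_div_iff₀ hls] at h1
  rw [div_div, le_div_iff₀ (by positivity)] at h2
  have hsq : ((c * Real.log n) ^ (s / 2) * (√(l n) * (n : ℝ) ^ (-(s / 2)))) ^ 2 =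
      c ^ s * Real.log n ^ s * l n / (n : ℝ) ^ s := by
    rw [mul_pow, mul_pow, Real.sq_sqrt hl.le, ← Real.rpow_natCast, ← Real.rpow_mul (by positivity),
      ← Real.rpow_natCast (_ ^ (-(s / 2))), ← Real.rpow_mul hn0.le]
    have e1 : s / 2 * ((2 : ℕ) : ℝ) = s := by push_cast; ring
    have e2 : -(s / 2) * ((2 : ℕ) : ℝ) = -s := by push_cast; ring
    rw [e1, e2, Real.rpow_neg hn0.le, Real.mul_rpow hc.le hlog.le]
    ring
  rw [scaledMax, le_div_iff₀ (by positivity)]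
  refine le_min ?_ ?_
  · refine le_of_sq_le_sq ?_ zero_le_one
    rw [hsq, div_le_iff₀ hns]
    linarith
  · refine le_of_sq_le_sq ?_ hl.le
    rw [hsq, div_le_iff₀ hns]
    nlinarith

theorem modelLaw_exists_lt_blockMin_le {s : ℝ} (hs : 0 < s) {l : ℝ} (hl : 0 < l) {n : ℕ}
    (hn : 2 ≤ n) (hR : (4 / volConst s * Real.log n) ^ (s / 2) ≤ scaledMax s l n) :
    modelLaw s n {ω | ∃ v, min 1 l < blockMin l (ω v)} ≤ ENNReal.ofReal (n : ℝ)⁻¹ := by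
  have hn' : (1 : ℝ) < n := by exact_mod_cast hn
  have hn0 : (0 : ℝ) < n := by linarith
  have hlog := Real.log_pos hn'
  have hK := volConst_pos hs
  have hset : {ω : InBlocks n | ∃ v, min 1 l < blockMin l (ω v)} =
      ⋃ v, {ω : InBlocks n | ω v ∈ {x | min 1 l < blockMin l x}} := by
    ext ω; simp
  have hone : ∀ v : Fin n,
      modelLaw s n {ω | ω v ∈ {x | min 1 l < blockMin l x}} ≤ ENNReal.ofReal ((n : ℝ)⁻¹ ^ 2) := by
    intro v
    have := nonempty_ne hn v
    rw [modelLaw_eval_preimage s v (measurableSet_lt measurable_const (measurable_blockMin l)),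
      ← ofReal_measureReal]
    refine ENNReal.ofReal_le_ofReal ?_
    have hR0 : 0 ≤ scaledMax s l n := le_trans (by positivity) hR
    obtain ⟨h1, h2⟩ := blockLaw_lt_blockMin_scaled (ι := {u : Fin n // u ≠ v}) hs hl
      (by omega) (card_ne v) hR0 le_rfl
    have ha : √l * (n : ℝ) ^ (-(s / 2)) ≠ 0 := by positivity
    rw [scaledMax, div_mul_cancel₀ _ ha, ← scaledMax] at h1
    rw [h1]
    refine (scaledTail_le hs hn hR0 h2).trans ?_
    -- The factor 4 makes the tail bound at most `n ^ (-2)`, which survives a union over `n`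
    -- vertices.
    have h3 : 4 / volConst s * Real.log n ≤ scaledMax s l n ^ (2 / s) := by
      have := Real.rpow_le_rpow (by positivity) hR (z := 2 / s) (by positivity)
      rwa [← Real.rpow_mul (by positivity), show s / 2 * (2 / s) = 1 by field_simp,
        Real.rpow_one] at this
    have h4 : -(volConst s / 2) * scaledMax s l n ^ (2 / s) ≤ ((2 : ℕ) : ℝ) * Real.log (n : ℝ)⁻¹ := by
      have h5 := mul_le_mul_of_nonneg_left h3 (half_pos hK).le
      have h6 : volConst s / 2 * (4 / volConst s * Real.log n) = 2 * Real.log n := by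
        field_simp; ring
      rw [Real.log_inv]
      push_cast
      linarith
    refine (Real.exp_le_exp.2 h4).trans_eq ?_
    rw [Real.exp_nat_mul, Real.exp_log (by positivity)]
  rw [hset]
  refine (measure_iUnion_fintype_le _ _).trans ((Finset.sum_le_sum fun v _ => hone v).trans_eq ?_)
  rw [Finset.sum_const, Finset.card_univ, Fintype.card_fin, ← ENNReal.ofReal_nsmul, nsmul_eq_mul]
  congr 1
  field_simp

/-- All the vertices have a cheap incoming edge, and `lagrangeSum` is close to its mean. -/
def Concentrated (s κ l : ℝ) {n : ℕ} (ω : InBlocks n) : Prop :=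
  (∀ v, blockMin l (ω v) ≤ min 1 l) ∧
    |lagrangeSum l ω - Cs s * (n : ℝ) ^ (1 - s / 2) * √l| ≤ κ * ((n : ℝ) ^ (1 - s / 2) * √l)

theorem tendsto_modelLaw_not_concentrated {s : ℝ} (hs : 0 < s) {l : ℕ → ℝ}
    (hl : ∀ᶠ n in atTop, 0 < l n)
    (h1 : Tendsto (fun n : ℕ => l n * ((n : ℝ) / Real.log n) ^ s) atTop atTop)
    (h2 : Tendsto (fun n : ℕ => ((n : ℝ) / Real.log n) ^ s / l n) atTop atTop)
    {κ : ℝ} (hκ : 0 < κ) :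
    Tendsto (fun n => modelLaw s n {ω | ¬ Concentrated s κ (l n) ω}) atTop (𝓝 0) := by
  have hK := volConst_pos hs
  have hRtop : Tendsto (fun n : ℕ => scaledMax s (l n) n) atTop atTop := by
    refine tendsto_atTop_mono' _ (eventually_le_scaledMax hl h1 h2 one_pos) ?_
    simp only [one_mul]
    exact (tendsto_rpow_atTop (half_pos hs)).comp
      (Real.tendsto_log_atTop.comp tendsto_natCast_atTop_atTop)
  have hmean : Tendsto (fun n : ℕ => scaledMean s (l n) n) atTop (𝓝 (Cs s)) := by
    refine tendsto_integral_scaledTail hs hRtop ?_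
    filter_upwards [hl, eventually_ge_atTop 2] with n hl hn y hy hyR
    obtain ⟨v⟩ : Nonempty (Fin n) := ⟨⟨0, by omega⟩⟩
    have := nonempty_ne hn v
    exact (blockLaw_lt_blockMin_scaled (ι := {u : Fin n // u ≠ v}) hs hl (by omega)
      (card_ne _) hy hyR).2
  have hbound : ∀ᶠ n : ℕ in atTop, modelLaw s n {ω | ¬ Concentrated s κ (l n) ω} ≤
      ENNReal.ofReal (n : ℝ)⁻¹ + ENNReal.ofReal (secondMomentBound s / (κ / 2) ^ 2 / n) := by
    filter_upwards [hl, eventually_ge_atTop 2,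
      eventually_le_scaledMax hl h1 h2 (c := 4 / volConst s) (by positivity),
      hmean.eventually (Metric.closedBall_mem_nhds _ (half_pos hκ))] with n hl hn hR hm
    have hn0 : (0 : ℝ) < n := by exact_mod_cast (by omega : 0 < n)
    refine le_trans (measure_mono ?_) ((measure_union_le _ _).trans
      (add_le_add (modelLaw_exists_lt_blockMin_le hs hl hn hR)
        (modelLaw_deviation_le hs hl hn (half_pos hκ))))
    intro ω hω
    by_contra hcon
    simp only [Set.mem_union, Set.mem_ofPred_eq, not_or, not_exists, not_lt, not_le] at hcon
    obtain ⟨ha, hb⟩ := hcon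
    refine hω ⟨ha, ?_⟩
    rw [Real.dist_eq] at hm
    have hb0 : 0 < √(l n) * (n : ℝ) ^ (-(s / 2)) := by positivity
    set b : ℝ := √(l n) * (n : ℝ) ^ (-(s / 2)) with hb'
    have hnb : (n : ℝ) ^ (1 - s / 2) * √(l n) = n * b := by
      rw [hb', sub_eq_add_neg, Real.rpow_add hn0, Real.rpow_one]; ring
    -- On this event the truncation is inactive at every vertex.
    have hsum : lagrangeSum (l n) ω = b * ∑ v, scaledMin s (l n) n (ω v) := by
      rw [lagrangeSum, Finset.mul_sum]
      refine Finset.sum_congr rfl fun v _ => ?_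
      rw [scaledMin, min_eq_left (ha v), ← hb', mul_div_cancel₀ _ hb0.ne']
    rw [mul_assoc, hnb, hsum]
    have h3 : |(∑ v, scaledMin s (l n) n (ω v)) - n * Cs s| ≤ κ * n := by
      calc _ = |((∑ v, scaledMin s (l n) n (ω v)) - n * scaledMean s (l n) n)
            + n * (scaledMean s (l n) n - Cs s)| := by congr 1; ring
        _ ≤ _ := abs_add_le _ _
        _ ≤ κ / 2 * n + n * (κ / 2) := by
            rw [abs_mul, abs_of_pos hn0]; gcongr
        _ = κ * n := by ring
    calc _ = b * |(∑ v, scaledMin s (l n) n (ω v)) - n * Cs s| := by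
          rw [← abs_of_pos hb0, ← abs_mul, abs_of_pos hb0]; congr 1; ring
      _ ≤ b * (κ * n) := by gcongr
      _ = _ := by ring
  refine tendsto_of_tendsto_of_tendsto_of_le_of_le' tendsto_const_nhds ?_
    (Eventually.of_forall fun _ => zero_le) hbound
  have t1 : Tendsto (fun n : ℕ => ENNReal.ofReal (n : ℝ)⁻¹) atTop (𝓝 0) := by
    simpa using ENNReal.tendsto_ofReal (tendsto_inv_atTop_nhds_zero_nat (𝕜 := ℝ))
  have t2 : Tendsto (fun n : ℕ => ENNReal.ofReal (secondMomentBound s / (κ / 2) ^ 2 / n)) atTop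
      (𝓝 0) := by
    simpa using ENNReal.tendsto_ofReal
      (tendsto_const_div_atTop_nhds_zero_nat (secondMomentBound s / (κ / 2) ^ 2))
  simpa using t1.add t2

/-! ### The number of cycles of best incoming edges. -/

/-- The configurations of the edges into `v` for which the edge from `u` is a best one. -/
def minimizerSet (l : ℝ) {n : ℕ} (v u : Fin n) : Set ({u : Fin n // u ≠ v} → ℝ × ℝ) :=
  {x | ∃ h : u ≠ v, ∀ j, (x ⟨u, h⟩).1 + l * (x ⟨u, h⟩).2 ≤ (x j).1 + l * (x j).2}

theorem measurableSet_minimizerSet (l : ℝ) {n : ℕ} (v u : Fin n) :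
    MeasurableSet (minimizerSet l v u) := by
  by_cases h : u ≠ v
  · have : minimizerSet l v u = ⋂ j, {x : {u : Fin n // u ≠ v} → ℝ × ℝ |
        (x ⟨u, h⟩).1 + l * (x ⟨u, h⟩).2 ≤ (x j).1 + l * (x j).2} := by
      ext x; simp [minimizerSet, h]
    rw [this]
    exact MeasurableSet.iInter fun j => measurableSet_le (by fun_prop) (by fun_prop)
  · have : minimizerSet l v u = ∅ := by ext x; simp [minimizerSet, h]
    rw [this]; exact MeasurableSet.empty

theorem blockLaw_minimizerSet_le {s : ℝ} (hs : 0 < s) (l : ℝ) {n : ℕ} (v u : Fin n) :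
    blockLaw s {u : Fin n // u ≠ v} (minimizerSet l v u) ≤ ((n - 1 : ℕ) : ENNReal)⁻¹ := by
  by_cases h : u ≠ v
  · have : minimizerSet l v u = {x : {u : Fin n // u ≠ v} → ℝ × ℝ | ∀ j,
        (x ⟨u, h⟩).1 + l * (x ⟨u, h⟩).2 ≤ (x j).1 + l * (x j).2} := by
      ext x; simp [minimizerSet, h]
    rw [this, ← card_ne v]
    exact blockLaw_minimizer_le hs l _
  · have : minimizerSet l v u = ∅ := by ext x; simp [minimizerSet, h]
    rw [this]; simp

/-- The possible vertex sequences of cycles of length `k + 1` with greatest vertex `v`, starting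
at `v`. -/
def cycleSeqs {n : ℕ} (v : Fin n) (k : ℕ) : Finset (Fin (k + 1) → Fin n) :=
  Finset.univ.filter fun y => Function.Injective y ∧ y 0 = v ∧ ∀ i : Fin k, y i.succ < v

theorem card_cycleSeqs_le {n : ℕ} (v : Fin n) (k : ℕ) : (cycleSeqs v k).card ≤ (v : ℕ) ^ k := by
  have h : (Fintype.piFinset fun _ : Fin k => Finset.Iio v).card = (v : ℕ) ^ k := by
    simp [Fintype.card_piFinset]
  rw [← h]
  refine Finset.card_le_card_of_injOn (fun y i => y i.succ) ?_ ?_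
  · intro y hy
    simp only [cycleSeqs, Finset.coe_filter, Finset.mem_univ, true_and, Set.mem_ofPred_eq] at hy
    simpa using hy.2.2
  · intro y hy z hz hyz
    simp only [cycleSeqs, Finset.coe_filter, Finset.mem_univ, true_and, Set.mem_ofPred_eq] at hy hz
    funext i
    refine Fin.cases ?_ (fun j => congrFun hyz j) i
    rw [hy.2.1, hz.2.1]

/-- The event that `v` is the greatest vertex of a cycle consisting of best incoming edges. -/
def cycleEvent (l : ℝ) {n : ℕ} (v : Fin n) : Set (InBlocks n) :=
  ⋃ k ∈ Finset.range n, ⋃ y ∈ cycleSeqs v k, ⋂ i, {ω | ω (y i) ∈ minimizerSet l (y i) (y (i + 1))}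

theorem measurableSet_cycleEvent (l : ℝ) {n : ℕ} (v : Fin n) :
    MeasurableSet (cycleEvent l v) :=
  Finset.measurableSet_biUnion _ fun _ _ => Finset.measurableSet_biUnion _ fun y _ =>
    MeasurableSet.iInter fun i =>
      measurable_pi_apply (y i) (measurableSet_minimizerSet l (y i) (y (i + 1)))

/-- The heads `y i` are distinct, so the events concern independent blocks. The index `i + 1` wraps
around in `Fin (k + 1)` and closes the cycle; for `k = 0` the event is empty. -/
theorem modelLaw_cycle_le {s : ℝ} (hs : 0 < s) (l : ℝ) {n k : ℕ} {y : Fin (k + 1) → Fin n}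
    (hy : Function.Injective y) :
    modelLaw s n (⋂ i, {ω | ω (y i) ∈ minimizerSet l (y i) (y (i + 1))}) ≤
      ((n - 1 : ℕ) : ENNReal)⁻¹ ^ (k + 1) := by
  have hind : iIndepFun (fun (v : Fin n) (ω : InBlocks n) => ω v) (modelLaw s n) :=
    iIndepFun_pi (μ := fun v : Fin n => blockLaw s {u : Fin n // u ≠ v}) (X := fun _ x => x)
      fun _ => aemeasurable_id
  have h := (hind.precomp hy).meas_iInter
    (s := fun i => {ω : InBlocks n | ω (y i) ∈ minimizerSet l (y i) (y (i + 1))})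
    fun i => ⟨_, measurableSet_minimizerSet l (y i) (y (i + 1)), rfl⟩
  rw [h]
  refine (Finset.prod_le_prod' (g := fun _ => ((n - 1 : ℕ) : ENNReal)⁻¹) fun i _ => ?_).trans_eq
    (by rw [Finset.prod_const, Finset.card_univ, Fintype.card_fin])
  rw [modelLaw_eval_preimage s _ (measurableSet_minimizerSet l (y i) (y (i + 1)))]
  exact blockLaw_minimizerSet_le hs l _ _

/-- Recording a cycle by its greatest vertex `v` leaves at most `v ^ k` sequences of length `k + 1`.
With `m = n - 1` the union bound is then a geometric series of ratio `v / m < 1`, with sum at most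
`1 / (m - v)`. -/
theorem modelLaw_cycleEvent_le {s : ℝ} (hs : 0 < s) (l : ℝ) {n : ℕ} (v : Fin n)
    (hv : (v : ℕ) < n - 1) :
    modelLaw s n (cycleEvent l v) ≤ ENNReal.ofReal (((n - 1 - v : ℕ) : ℝ)⁻¹) := by
  have hp : (((n - 1 : ℕ) : ENNReal))⁻¹ = ENNReal.ofReal (((n - 1 : ℕ) : ℝ)⁻¹) := by
    rw [ENNReal.ofReal_inv_of_pos (by exact_mod_cast (by omega : 0 < n - 1)),
      ENNReal.ofReal_natCast]
  have hm : (0 : ℝ) < ((n - 1 : ℕ) : ℝ) := by exact_mod_cast (by omega : 0 < n - 1)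
  have hvm : ((v : ℕ) : ℝ) < ((n - 1 : ℕ) : ℝ) := by exact_mod_cast hv
  set m : ℝ := ((n - 1 : ℕ) : ℝ) with hm'
  have h1 : modelLaw s n (cycleEvent l v) ≤
      ∑ k ∈ Finset.range n, ENNReal.ofReal (m⁻¹ * ((v : ℕ) * m⁻¹) ^ k) := by
    refine (measure_biUnion_finset_le _ _).trans (Finset.sum_le_sum fun k _ => ?_)
    refine (measure_biUnion_finset_le _ _).trans ?_
    refine (Finset.sum_le_card_nsmul _ _ (ENNReal.ofReal (m⁻¹ ^ (k + 1))) fun y hy => ?_).trans ?_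
    · rw [ENNReal.ofReal_pow (by positivity), ← hp]
      simp only [cycleSeqs, Finset.mem_filter] at hy
      exact modelLaw_cycle_le hs l hy.2.1
    · rw [← ENNReal.ofReal_nsmul, nsmul_eq_mul]
      refine ENNReal.ofReal_le_ofReal ?_
      have h2 : (((cycleSeqs v k).card : ℕ) : ℝ) ≤ ((v : ℕ) : ℝ) ^ k := by
        exact_mod_cast card_cycleSeqs_le v k
      calc _ ≤ ((v : ℕ) : ℝ) ^ k * m⁻¹ ^ (k + 1) := by gcongr
        _ = _ := by rw [mul_pow, pow_succ]; ring
  refine h1.trans ?_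
  rw [← ENNReal.ofReal_sum_of_nonneg fun k _ => by positivity]
  refine ENNReal.ofReal_le_ofReal ?_
  have hr0 : 0 ≤ ((v : ℕ) : ℝ) * m⁻¹ := by positivity
  have hr1 : ((v : ℕ) : ℝ) * m⁻¹ < 1 := by
    rwa [← div_eq_mul_inv, div_lt_one hm]
  rw [← Finset.mul_sum]
  have h3 : ∑ k ∈ Finset.range n, (((v : ℕ) : ℝ) * m⁻¹) ^ k ≤ (1 - ((v : ℕ) : ℝ) * m⁻¹)⁻¹ := by
    rw [← tsum_geometric_of_lt_one hr0 hr1]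
    exact (summable_geometric_of_lt_one hr0 hr1).sum_le_tsum _ fun k _ => by positivity
  refine (mul_le_mul_of_nonneg_left h3 (by positivity)).trans_eq ?_
  rw [← mul_inv, mul_sub, mul_one, mul_comm ((v : ℕ) : ℝ), mul_inv_cancel_left₀ hm.ne',
    Nat.cast_sub (by omega)]

theorem sum_modelLaw_cycleEvent_le {s : ℝ} (hs : 0 < s) (l : ℝ) {n : ℕ} (hn : 2 ≤ n) :
    ∑ v : Fin n, modelLaw s n (cycleEvent l v) ≤ ENNReal.ofReal (2 + Real.log n) := by
  obtain ⟨m, rfl⟩ : ∃ m, n = m + 1 := ⟨n - 1, by omega⟩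
  have hm1 : (1 : ℝ) ≤ m := by exact_mod_cast (by omega : 1 ≤ m)
  -- The last vertex has ratio 1 and gets the trivial bound 1; the others add up to a harmonic sum.
  rw [Fin.sum_univ_castSucc]
  have h1 : ∑ v : Fin m, modelLaw s (m + 1) (cycleEvent l v.castSucc) ≤
      ENNReal.ofReal (1 + Real.log m) := by
    refine (Finset.sum_le_sum fun v _ => modelLaw_cycleEvent_le hs l v.castSucc
      (by simp)).trans ?_
    rw [← ENNReal.ofReal_sum_of_nonneg fun k _ => by positivity]
    refine ENNReal.ofReal_le_ofReal ?_
    have h2 := harmonic_le_one_add_log m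
    refine le_trans (le_of_eq ?_) h2
    rw [harmonic]
    push_cast
    rw [← Finset.sum_range_reflect, ← Fin.sum_univ_eq_sum_range
      (fun j => (((m - 1 - j : ℕ) : ℝ) + 1)⁻¹)]
    refine Finset.sum_congr rfl fun v _ => ?_
    have hv := v.2
    rw [show m - ((v.castSucc : Fin (m + 1)) : ℕ) = m - 1 - v + 1 by
      simp only [Fin.val_castSucc]; omega]
    push_cast
    rfl
  refine (add_le_add h1 prob_le_one).trans ?_
  rw [← ENNReal.ofReal_one, ← ENNReal.ofReal_add (by have := Real.log_nonneg hm1; linarith)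
    zero_le_one]
  refine ENNReal.ofReal_le_ofReal ?_
  have := Real.log_le_log (by linarith) (show (m : ℝ) ≤ ((m + 1 : ℕ) : ℝ) by push_cast; linarith)
  linarith

open Classical in
/-- The vertices `v` for which `cycleEvent` occurs. -/
noncomputable def cycleTops (l : ℝ) {n : ℕ} (ω : InBlocks n) : Finset (Fin n) :=
  Finset.univ.filter fun v => ω ∈ cycleEvent l v

theorem mem_cycleTops {l : ℝ} {n : ℕ} {ω : InBlocks n} {v : Fin n} :
    v ∈ cycleTops l ω ↔ ω ∈ cycleEvent l v := by
  simp [cycleTops]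

theorem modelLaw_card_cycleTops_le {s : ℝ} (hs : 0 < s) (l : ℝ) {n : ℕ} (hn : 2 ≤ n) {a : ℝ}
    (ha : 0 < a) :
    modelLaw s n {ω | a ≤ (cycleTops l ω).card} ≤ ENNReal.ofReal ((2 + Real.log n) / a) := by
  classical
  have hcard : ∀ ω : InBlocks n, ENNReal.ofReal ((cycleTops l ω).card : ℝ) =
      ∑ v, (cycleEvent l v).indicator 1 ω := by
    intro ω
    rw [ENNReal.ofReal_natCast, cycleTops, Finset.card_filter]
    push_cast
    exact Finset.sum_congr rfl fun v _ => by simp [Set.indicator_apply]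
  have hsub : {ω : InBlocks n | a ≤ (cycleTops l ω).card} ⊆
      {ω | ENNReal.ofReal a ≤ ∑ v, (cycleEvent l v).indicator 1 ω} := by
    intro ω hω
    simp only [Set.mem_ofPred_eq, ← hcard]
    exact ENNReal.ofReal_le_ofReal hω
  have hmeas : ∀ v : Fin n, Measurable fun ω : InBlocks n =>
      (cycleEvent l v).indicator (1 : InBlocks n → ENNReal) ω :=
    fun v => measurable_one.indicator (measurableSet_cycleEvent l v)
  refine (measure_mono hsub).trans ((meas_ge_le_lintegral_div
    (Finset.measurable_sum _ fun v _ => hmeas v).aemeasurable (by simpa using ha)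
    ENNReal.ofReal_ne_top).trans ?_)
  rw [lintegral_finsetSum _ fun v _ => hmeas v, ENNReal.ofReal_div_of_pos ha]
  gcongr
  simp_rw [lintegral_indicator_one (measurableSet_cycleEvent l _)]
  exact sum_modelLaw_cycleEvent_le hs l hn

/-- Every cycle of a map that selects best incoming edges meets `cycleTops`. -/
theorem exists_iterate_mem_cycleTops {l : ℝ} {n : ℕ} {ω : InBlocks n} {f : Fin n → Fin n}
    (hf : ∀ v, ω v ∈ minimizerSet l v (f v)) (v : Fin n) : ∃ k, f^[k] v ∈ cycleTops l ω := by
  obtain ⟨i, j, hij, hrep⟩ := Finite.exists_ne_map_eq_of_infinite fun k : ℕ => f^[k] v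
  wlog hlt : i < j generalizing i j
  · exact this j i hij.symm hrep.symm (lt_of_le_of_ne (not_lt.1 hlt) hij.symm)
  set x := f^[i] v with hx
  have hper : f^[j - i] x = x := by
    rw [hx, ← Function.iterate_add_apply, Nat.sub_add_cancel hlt.le]
    exact hrep.symm
  -- Start the periodic orbit at its greatest vertex, as `cycleSeqs` requires.
  obtain ⟨w, hw⟩ : ∃ w, w ∈ Set.range (fun k : ℕ => f^[k] x) ∧
      ∀ z ∈ Set.range (fun k : ℕ => f^[k] x), z ≤ w := by
    obtain ⟨w, hw⟩ := (Set.toFinite (Set.range fun k : ℕ => f^[k] x)).exists_maximal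
      (Set.range_nonempty _)
    exact ⟨w, hw.1, fun z hz => (le_total z w).elim id fun h => hw.2 hz h⟩
  obtain ⟨⟨k, rfl⟩, hmax⟩ := hw
  refine ⟨k + i, ?_⟩
  rw [Function.iterate_add_apply, ← hx]
  simp only at hmax
  set w := f^[k] x with hw
  have hwper : w ∈ Function.periodicPts f := by
    refine ⟨j - i, by omega, ?_⟩
    rw [Function.IsPeriodicPt, Function.IsFixedPt, hw, ← Function.iterate_add_apply, add_comm,
      Function.iterate_add_apply, hper]
  have hpos := Function.minimalPeriod_pos_of_mem_periodicPts hwper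
  obtain ⟨p, hp⟩ : ∃ p, Function.minimalPeriod f w = p + 1 := ⟨_, (Nat.succ_pred hpos.ne').symm⟩
  have hinj : Function.Injective fun i : Fin (p + 1) => f^[i] w := by
    intro a b hab
    exact Fin.ext ((Function.iterate_injOn_Iio_minimalPeriod (f := f) (x := w))
      (by rw [hp]; exact a.2) (by rw [hp]; exact b.2) hab)
  simp only [mem_cycleTops, cycleEvent, Set.mem_iUnion, Set.mem_iInter]
  refine ⟨p, ?_, fun i : Fin (p + 1) => f^[(i : ℕ)] w, ?_, ?_⟩
  · have := Fintype.card_le_of_injective _ hinj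
    simp only [Fintype.card_fin] at this
    simpa using this
  · simp only [cycleSeqs, Finset.mem_filter, Finset.mem_univ, true_and]
    refine ⟨hinj, rfl, fun a => lt_of_le_of_ne (hmax _ ⟨a.succ + k, ?_⟩) ?_⟩
    · simp only [hw, ← Function.iterate_add_apply]
    · intro h
      have := @hinj a.succ 0 (by simpa using h)
      exact Fin.succ_ne_zero a this
  · intro a
    have hnext : f^[((a + 1 : Fin (p + 1)) : ℕ)] w = f (f^[a] w) := by
      rw [← Function.iterate_succ_apply' f]
      rw [Fin.val_add_one]
      split_ifs with h
      · have hit := Function.iterate_minimalPeriod (f := f) (x := w)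
        rw [hp] at hit
        rw [h, Fin.val_last, Nat.succ_eq_add_one, hit]
        rfl
      · rfl
    simp only [Set.mem_ofPred_eq]
    rw [hnext]
    exact hf _

/-! ### Arborescences compared with choices of incoming edges, and weak duality. -/

theorem exists_mem_of_ne_root {n : ℕ} {A : Finset (Edge n)} (hA : IsSpanningArborescence A) :
    ∃ r : Fin n, ∀ v, v ≠ r → ∃ e ∈ A, e.1.2 = v := by
  obtain ⟨hA⟩ := hA
  refine ⟨Quiver.root (Spanning A), fun v hv => ?_⟩
  obtain ⟨p⟩ : Nonempty (Quiver.Path (Quiver.root (Spanning A)) (v : Spanning A)) :=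
    ⟨(Quiver.Arborescence.uniquePath (V := Spanning A) v).default⟩
  cases p with
  | nil => exact absurd rfl hv
  | cons p e =>
    obtain ⟨e, he, -, hev⟩ := e
    exact ⟨e, he, hev⟩

/-- The total length of a spanning arborescence is bounded below by the sum of the least lengths of
the incoming edges over all vertices but the root. -/
theorem sum_sub_le_of_isSpanningArborescence {n : ℕ} {A : Finset (Edge n)}
    (hA : IsSpanningArborescence A) {X : Edge n → ℝ} (hX : ∀ e, 0 ≤ X e) {m : Fin n → ℝ}
    (hm : ∀ e : Edge n, m e.1.2 ≤ X e) : ∃ r, ∑ v, m v - m r ≤ ∑ e ∈ A, X e := by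
  classical
  obtain ⟨r, hr⟩ := exists_mem_of_ne_root hA
  refine ⟨r, ?_⟩
  have hfib : ∀ v, 0 ≤ ∑ e ∈ A with e.1.2 = v, X e := fun v => Finset.sum_nonneg fun e _ => hX e
  rw [sub_le_iff_le_add, ← Finset.sum_erase_add _ _ (Finset.mem_univ r)]
  gcongr
  calc ∑ v ∈ Finset.univ.erase r, m v
      ≤ ∑ v ∈ Finset.univ.erase r, ∑ e ∈ A with e.1.2 = v, X e := by
        refine Finset.sum_le_sum fun v hv => ?_
        obtain ⟨e, heA, rfl⟩ := hr v (Finset.ne_of_mem_erase hv)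
        exact (hm e).trans (Finset.single_le_sum (fun e _ => hX e) (by simp [heA]))
    _ ≤ ∑ v, ∑ e ∈ A with e.1.2 = v, X e :=
        Finset.sum_le_sum_of_subset_of_nonneg (Finset.subset_univ _) fun v _ _ => hfib v
    _ = ∑ e ∈ A, X e := Finset.sum_fiberwise _ _ _

/-- A map without fixed points, all of whose cycles meet `D`, gives rise to a spanning
arborescence by redirecting the vertices in `D` to a root. -/
theorem exists_isSpanningArborescence {n : ℕ} (hn : 0 < n) {f : Fin n → Fin n}
    (hf : ∀ v, f v ≠ v) {D : Finset (Fin n)} (hD : ∀ v, ∃ k, f^[k] v ∈ D) :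
    ∃ A : Finset (Edge n), IsSpanningArborescence A ∧
      ∀ Y : Edge n → ℝ, (∀ e, 0 ≤ Y e) → (∀ e, Y e ≤ 1) →
        ∑ e ∈ A, Y e ≤ ∑ v, Y ⟨(f v, v), hf v⟩ + D.card := by
  classical
  obtain ⟨r, hr⟩ : ∃ r, r ∈ D := ⟨_, (hD ⟨0, hn⟩).choose_spec⟩
  set g : Fin n → Fin n := fun v => if v ∈ D then r else f v with hg
  set A : Finset (Edge n) := Finset.univ.filter fun e => e.1.2 ≠ r ∧ e.1.1 = g e.1.2 with hA
  have hmem : ∀ e : Edge n, e ∈ A ↔ e.1.2 ≠ r ∧ e.1.1 = g e.1.2 := fun e => by simp [hA]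
  have hhead : ∀ e ∈ A, ∀ e' ∈ A, e.1.2 = e'.1.2 → e = e' := by
    intro e he e' he' h
    refine Subtype.ext (Prod.ext ?_ h)
    rw [((hmem e).1 he).2, ((hmem e').1 he').2, h]
  refine ⟨A, ⟨?_⟩, ?_⟩
  -- The height is the hitting time of `D` under `f` plus one, and 0 at the root. It increases along
  -- every edge of `A`, which excludes cycles.
  · set ht : Fin n → ℕ := fun v => if v = r then 0 else Nat.find (hD v) + 1 with hht
    have hlt : ∀ e ∈ A, ht e.1.1 < ht e.1.2 := by
      intro e he
      obtain ⟨h1, h2⟩ := (hmem e).1 he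
      simp only [hht, if_neg h1, h2]
      by_cases h3 : g e.1.2 = r
      · simp [h3]
      · rw [if_neg h3]
        have h4 : e.1.2 ∉ D := fun h4 => h3 (by simp [hg, h4])
        have h5 : g e.1.2 = f e.1.2 := by simp [hg, h4]
        have h6 : Nat.find (hD e.1.2) ≠ 0 := by
          intro h0
          exact h4 (by simpa [h0] using Nat.find_spec (hD e.1.2))
        obtain ⟨k, hk⟩ := Nat.exists_eq_succ_of_ne_zero h6
        have h7 : f^[k] (g e.1.2) ∈ D := by
          rw [h5, ← Function.iterate_succ_apply, ← hk]
          exact Nat.find_spec (hD e.1.2)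
        have h8 := Nat.find_min' (hD (g e.1.2)) h7
        omega
    refine Quiver.arborescenceMk (V := Spanning A) r ht ?_ ?_ ?_
    · rintro a b ⟨e, he, rfl, rfl⟩
      exact hlt e he
    · rintro a b c ⟨e, he, ha, hc⟩ ⟨e', he', hb, hc'⟩
      obtain rfl := hhead e he e' he' (hc.trans hc'.symm)
      subst ha
      subst hb
      exact ⟨rfl, HEq.rfl⟩
    · intro v
      by_cases hv : (v : Fin n) = r
      · exact Or.inl hv
      · right
        have hgv : g v ≠ v := by
          by_cases h : (show Fin n from v) ∈ D
          · simp only [hg, if_pos h]; exact Ne.symm hv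
          · simp only [hg, if_neg h]; exact hf v
        exact ⟨g v, ⟨⟨(g v, v), hgv⟩, (hmem _).2 ⟨hv, rfl⟩, rfl, rfl⟩⟩
  · intro Y hY0 hY1
    -- A redirected edge contributes at most 1, charged to its head in `D`.
    set h : Fin n → ℝ := fun v => Y ⟨(f v, v), hf v⟩ + if v ∈ D then 1 else 0 with hh
    have h0 : ∀ v, 0 ≤ h v := fun v => add_nonneg (hY0 _) (by split_ifs <;> norm_num)
    calc ∑ e ∈ A, Y e ≤ ∑ e ∈ A, h e.1.2 := by
          refine Finset.sum_le_sum fun e he => ?_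
          obtain ⟨-, h2⟩ := (hmem e).1 he
          by_cases h3 : e.1.2 ∈ D
          · simp only [hh, if_pos h3]
            linarith [hY0 ⟨(f e.1.2, e.1.2), hf _⟩, hY1 e]
          · simp only [hh, if_neg h3, add_zero]
            have h4 : e = ⟨(f e.1.2, e.1.2), hf _⟩ := by
              refine Subtype.ext (Prod.ext ?_ rfl)
              rw [h2]
              simp [hg, h3]
            exact (congrArg Y h4).le
      _ = ∑ v ∈ A.image fun e => e.1.2, h v :=
          (Finset.sum_image fun e he e' he' => hhead e he e' he').symm
      _ ≤ ∑ v, h v := Finset.sum_le_sum_of_subset_of_nonneg (Finset.subset_univ _) fun v _ _ => h0 v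
      _ = _ := by simp [hh, Finset.sum_add_distrib]

theorem finite_feasibleWeights {n : ℕ} (W C : Edge n → ℝ) (c : ℝ) :
    (feasibleWeights W C c).Finite := by
  refine (Set.finite_range fun A : Finset (Edge n) => ∑ e ∈ A, W e).subset ?_
  rintro w ⟨A, -, -, rfl⟩
  exact ⟨A, rfl⟩

theorem exists_isOptimalWeight {n : ℕ} {W C : Edge n → ℝ} {c w : ℝ}
    (hw : w ∈ feasibleWeights W C c) : ∃ w' ≤ w, IsOptimalWeight W C c w' := by
  obtain ⟨w', hw'⟩ := (finite_feasibleWeights W C c).exists_minimal ⟨w, hw⟩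
  have hleast : IsLeast (feasibleWeights W C c) w' :=
    ⟨hw'.1, fun z hz => (le_total w' z).elim id fun h => hw'.2 hz h⟩
  exact ⟨w', hleast.2 hw, hleast⟩

/-- The weight of an edge. -/
def InBlocks.weight {n : ℕ} (ω : InBlocks n) (e : Edge n) : ℝ := (ω e.1.2 ⟨e.1.1, e.2⟩).1

/-- The cost of an edge. -/
def InBlocks.cost {n : ℕ} (ω : InBlocks n) (e : Edge n) : ℝ := (ω e.1.2 ⟨e.1.1, e.2⟩).2

/-- All the weights and costs lie in the unit interval. -/
def InUnit {n : ℕ} (ω : InBlocks n) : Prop :=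
  ∀ v u, (ω v u).1 ∈ Set.Icc (0 : ℝ) 1 ∧ (ω v u).2 ∈ Set.Icc (0 : ℝ) 1

theorem ae_inUnit {s : ℝ} (hs : 0 < s) (n : ℕ) : ∀ᵐ ω ∂modelLaw s n, InUnit ω := by
  simp only [InUnit, ae_all_iff]
  intro v u
  have h : ∀ᵐ x ∂blockLaw s {u : Fin n // u ≠ v},
      (x u).1 ∈ Set.Icc (0 : ℝ) 1 ∧ (x u).2 ∈ Set.Icc (0 : ℝ) 1 :=
    (Measure.quasiMeasurePreserving_eval (fun _ : {u : Fin n // u ≠ v} => edgeLaw s) u).ae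
      (edgeLaw_ae_mem s hs)
  exact (Measure.quasiMeasurePreserving_eval
    (fun v : Fin n => blockLaw s {u : Fin n // u ≠ v}) v).ae h

/-- Weak duality. -/
theorem lagrangeSum_sub_le {n : ℕ} {ω : InBlocks n} (hω : InUnit ω) {l : ℝ} (hl : 0 ≤ l)
    (hmin : ∀ v, blockMin l (ω v) ≤ 1) {A : Finset (Edge n)} (hA : IsSpanningArborescence A) :
    lagrangeSum l ω - 1 ≤ ∑ e ∈ A, ω.weight e + l * ∑ e ∈ A, ω.cost e := by
  obtain ⟨r, hr⟩ := sum_sub_le_of_isSpanningArborescence hA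
    (X := fun e => ω.weight e + l * ω.cost e) (m := fun v => blockMin l (ω v))
    (fun e => add_nonneg (hω _ _).1.1 (mul_nonneg hl (hω _ _).2.1)) fun e => blockMin_le l _ _
  rw [Finset.mul_sum, ← Finset.sum_add_distrib]
  -- The loss of 1 covers the term of the root, which has no incoming edge.
  exact le_trans (sub_le_sub_left (hmin r) _) hr

/-- Redirecting the best incoming edges at `cycleTops` gives a spanning arborescence. -/
theorem exists_isSpanningArborescence_of_lagrangeSum {n : ℕ} (hn : 2 ≤ n) {ω : InBlocks n}
    (hω : InUnit ω) (l : ℝ) :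
    ∃ A : Finset (Edge n), IsSpanningArborescence A ∧ ∃ w c : ℝ,
      ∑ e ∈ A, ω.weight e ≤ w + (cycleTops l ω).card ∧
      ∑ e ∈ A, ω.cost e ≤ c + (cycleTops l ω).card ∧
      w + l * c = lagrangeSum l ω ∧ ∀ l', lagrangeSum l' ω ≤ w + l' * c := by
  have hne := fun v => nonempty_ne hn v
  choose g hg using fun v => exists_eq_blockMin l (ω v)
  obtain ⟨A, hA, hAY⟩ := exists_isSpanningArborescence (by omega) (f := fun v => (g v : Fin n))
    (fun v => (g v).2) (D := cycleTops l ω) fun v => exists_iterate_mem_cycleTops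
      (fun v => ⟨(g v).2, fun j => (hg v).trans_le (blockMin_le l _ j)⟩) v
  -- The witnesses are the totals before the repair. The same choice `g` competes at every other
  -- multiplier `l'`, so these totals define a supporting line of `lagrangeSum`.
  refine ⟨A, hA, ∑ v, (ω v (g v)).1, ∑ v, (ω v (g v)).2,
    hAY ω.weight (fun e => (hω _ _).1.1) fun e => (hω _ _).1.2,
    hAY ω.cost (fun e => (hω _ _).2.1) fun e => (hω _ _).2.2, ?_, fun l' => ?_⟩
  · rw [Finset.mul_sum, ← Finset.sum_add_distrib]
    exact Finset.sum_congr rfl fun v _ => hg v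
  · rw [Finset.mul_sum, ← Finset.sum_add_distrib]
    exact Finset.sum_le_sum fun v _ => blockMin_le l' _ _

/-! ### From concentration at four multipliers to the optimum. -/

/-- The supergradient inequalities for a function close to `2 * V * √(l * c₀ / V)`. -/
theorem supergradient_bounds {V c₀ η w c S₁ S₂ S₃ : ℝ} (hV : 0 < V) (hc₀ : 0 < c₀) (hη : 0 < η)
    (hη1 : η ≤ 1 / 20) (h₁ : w + (1 + 10 * η) ^ 2 * (V / c₀) * c = S₁)
    (h₂ : S₂ ≤ w + ((1 + 10 * η) * (1 - η)) ^ 2 * (V / c₀) * c)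
    (h₃ : S₃ ≤ w + ((1 + 10 * η) * (1 + η)) ^ 2 * (V / c₀) * c)
    (hS₁ : S₁ ≤ 2 * V * (1 + 10 * η) * (1 + η ^ 2))
    (hS₂ : 2 * V * ((1 + 10 * η) * (1 - η)) * (1 - η ^ 2) ≤ S₂)
    (hS₃ : 2 * V * ((1 + 10 * η) * (1 + η)) * (1 - η ^ 2) ≤ S₃) :
    c ≤ (1 - η) * c₀ ∧ w ≤ (1 + 18 * η) * V := by
  obtain ⟨x, rfl⟩ : ∃ x, c = x * c₀ := ⟨c / c₀, by field_simp⟩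
  obtain ⟨z, rfl⟩ : ∃ z, w = z * V := ⟨w / V, by field_simp⟩
  have e : ∀ a : ℝ, a * (V / c₀) * (x * c₀) = a * x * V := fun a => by field_simp
  rw [e] at h₁ h₂ h₃
  set q := 1 + 10 * η with hq
  have hq0 : 0 < q := by positivity
  -- Difference quotients over a relative step `η`: errors `η ^ 2` in the values become errors of
  -- order `η` in the slope, so `q * x = 1 + O(η)`.
  have k2 : (q * x) * (2 - η) ≤ 2 + 4 * η := by
    have h : η * q * V * ((q * x) * (2 - η)) ≤ η * q * V * (2 + 4 * η - 2 * η ^ 2) := by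
      nlinarith
    have := le_of_mul_le_mul_left h (by positivity)
    nlinarith
  have k3 : 2 - 4 * η - 2 * η ^ 2 ≤ (q * x) * (2 + η) := by
    have h : η * q * V * (2 - 4 * η - 2 * η ^ 2) ≤ η * q * V * ((q * x) * (2 + η)) := by
      nlinarith
    exact le_of_mul_le_mul_left h (by positivity)
  have k1 : z + q * (q * x) ≤ 2 * q * (1 + η ^ 2) := by
    have h : V * (z + q * (q * x)) ≤ V * (2 * q * (1 + η ^ 2)) := by nlinarith
    exact le_of_mul_le_mul_left h hV
  constructor
  · refine mul_le_mul_of_nonneg_right ?_ hc₀.le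
    -- The excess `10 * η` in `q` outweighs the slope error and still leaves a slack `η * c₀` for
    -- the repair.
    have h4 : 2 + 4 * η ≤ q * (1 - η) * (2 - η) := by rw [hq]; nlinarith [sq_nonneg η]
    have h5 : q * x ≤ q * (1 - η) :=
      le_of_mul_le_mul_right (k2.trans h4) (by linarith)
    exact le_of_mul_le_mul_left h5 hq0
  · refine mul_le_mul_of_nonneg_right ?_ hV.le
    have h6 : 1 - 3 * η ≤ q * x := by
      have : (1 - 3 * η) * (2 + η) ≤ (q * x) * (2 + η) := by nlinarith [sq_nonneg η]
      exact le_of_mul_le_mul_right this (by linarith)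
    have h7 : q * (1 - 3 * η) ≤ q * (q * x) := mul_le_mul_of_nonneg_left h6 hq0.le
    have h8 : z ≤ q * (1 + 3 * η + 2 * η ^ 2) := by linarith
    have h9 : 1 + 3 * η + 2 * η ^ 2 ≤ 1 + 4 * η := by nlinarith
    have h10 := mul_le_mul_of_nonneg_left h9 hq0.le
    have h11 : q * (1 + 4 * η) ≤ 1 + 18 * η := by rw [hq]; nlinarith
    linarith

/-- The asymptotic value of the minimum weight. -/
noncomputable def limitWeight (s : ℝ) (n : ℕ) (c : ℝ) : ℝ :=
  Cs s ^ 2 * (n : ℝ) ^ (2 - s) / (4 * c)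

/-- The multiplier `q ^ 2 * V / c`, where `V` is the asymptotic value of the minimum weight. -/
noncomputable def multiplier (s : ℝ) (n : ℕ) (c q : ℝ) : ℝ := q ^ 2 * (limitWeight s n c / c)

theorem limitWeight_pos {s : ℝ} (hs : 0 < s) {n : ℕ} (hn : 0 < n) {c : ℝ} (hc : 0 < c) :
    0 < limitWeight s n c := by
  have hn' : (0 : ℝ) < n := by exact_mod_cast hn
  have := Cs_pos hs
  unfold limitWeight
  positivity

theorem multiplier_pos {s : ℝ} (hs : 0 < s) {n : ℕ} (hn : 0 < n) {c q : ℝ} (hc : 0 < c)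
    (hq : 0 < q) : 0 < multiplier s n c q := by
  have := limitWeight_pos hs hn hc
  unfold multiplier
  positivity

theorem mul_sqrt_multiplier {s : ℝ} (hs : 0 < s) {n : ℕ} (hn : 0 < n) {c q : ℝ} (hc : 0 < c)
    (hq : 0 < q) :
    Cs s * ((n : ℝ) ^ (1 - s / 2) * √(multiplier s n c q)) = 2 * limitWeight s n c * q := by
  have hn' : (0 : ℝ) < n := by exact_mod_cast hn
  have hC := Cs_pos hs
  have hpow : (n : ℝ) ^ (2 - s) = ((n : ℝ) ^ (1 - s / 2)) ^ 2 := by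
    rw [← Real.rpow_natCast, ← Real.rpow_mul hn'.le]
    congr 1
    push_cast
    ring
  have hm : multiplier s n c q = (q * (Cs s * (n : ℝ) ^ (1 - s / 2)) / (2 * c)) ^ 2 := by
    rw [multiplier, limitWeight, hpow]
    field_simp
    ring
  rw [hm, Real.sqrt_sq (by positivity), limitWeight, hpow]
  field_simp
  ring

theorem Concentrated.abs_sub_le {s : ℝ} (hs : 0 < s) {n : ℕ} (hn : 0 < n) {c q κ : ℝ} (hc : 0 < c)
    (hq : 0 < q) {ω : InBlocks n} (h : Concentrated s (κ * Cs s) (multiplier s n c q) ω) :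
    |lagrangeSum (multiplier s n c q) ω - 2 * limitWeight s n c * q| ≤
      κ * (2 * limitWeight s n c * q) := by
  have h2 := h.2
  rwa [mul_assoc, mul_assoc κ, mul_sqrt_multiplier hs hn hc hq] at h2

/-- The configurations for which the minimum weight is close to its asymptotic value. -/
def GoodOptimum (s : ℝ) {n : ℕ} (c ε : ℝ) (W C : Edge n → ℝ) : Prop :=
  ∃ w, IsOptimalWeight W C c w ∧ (1 - ε) * w ≤ limitWeight s n c ∧ limitWeight s n c ≤ (1 + ε) * w

theorem goodOptimum_of_concentrated {s : ℝ} (hs : 0 < s) {n : ℕ} (hn : 2 ≤ n) {c η ε : ℝ}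
    (hc : 0 < c) (hη : 0 < η) (hη1 : η ≤ 1 / 20) (hηε : 19 * η ≤ ε)
    (hV : 1 ≤ η * limitWeight s n c) {ω : InBlocks n} (hω : InUnit ω)
    (h₀ : Concentrated s (η ^ 2 * Cs s) (multiplier s n c 1) ω)
    (h₁ : Concentrated s (η ^ 2 * Cs s) (multiplier s n c (1 + 10 * η)) ω)
    (h₂ : Concentrated s (η ^ 2 * Cs s) (multiplier s n c ((1 + 10 * η) * (1 - η))) ω)
    (h₃ : Concentrated s (η ^ 2 * Cs s) (multiplier s n c ((1 + 10 * η) * (1 + η))) ω)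
    (hD : ((cycleTops (multiplier s n c (1 + 10 * η)) ω).card : ℝ) ≤
      η * min c (limitWeight s n c)) :
    GoodOptimum s c ε ω.weight ω.cost := by
  have hn0 : 0 < n := by omega
  have hVpos := limitWeight_pos hs hn0 hc
  have hq : 0 < 1 + 10 * η := by linarith
  obtain ⟨A, hA, w, d, hw, hd, heq, hle⟩ :=
    exists_isSpanningArborescence_of_lagrangeSum hn hω (multiplier s n c (1 + 10 * η))
  have a₁ := abs_le.1 (h₁.abs_sub_le hs hn0 hc hq)
  have a₂ := abs_le.1 (h₂.abs_sub_le hs hn0 hc (mul_pos hq (by linarith)))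
  have a₃ := abs_le.1 (h₃.abs_sub_le hs hn0 hc (mul_pos hq (by linarith)))
  have hb := supergradient_bounds hVpos hc hη hη1 heq (hle (multiplier s n c _))
    (hle (multiplier s n c _)) (by linarith [a₁.2]) (by linarith [a₂.1]) (by linarith [a₃.1])
  have hDc : ((cycleTops (multiplier s n c (1 + 10 * η)) ω).card : ℝ) ≤ η * c :=
    hD.trans (mul_le_mul_of_nonneg_left (min_le_left _ _) hη.le)
  have hDV : ((cycleTops (multiplier s n c (1 + 10 * η)) ω).card : ℝ) ≤ η * limitWeight s n c :=
    hD.trans (mul_le_mul_of_nonneg_left (min_le_right _ _) hη.le)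
  obtain ⟨w', hw', hopt⟩ := exists_isOptimalWeight (W := ω.weight) (C := ω.cost) (c := c)
    ⟨A, hA, by linarith [hb.1], rfl⟩
  -- Here 18 comes from `supergradient_bounds` and 1 from the repair.
  have hupper : w' ≤ (1 + 19 * η) * limitWeight s n c := by linarith [hb.2]
  -- Weak duality at `q = 1`: the multiplier times `c` is exactly `limitWeight`, and `hV` absorbs
  -- the loss of 1 at the root.
  have hlower : (1 - 2 * η) * limitWeight s n c ≤ w' := by
    obtain ⟨B, hB, hBc, rfl⟩ := hopt.1
    have hl0 := multiplier_pos (q := 1) hs hn0 hc one_pos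
    have hdual := lagrangeSum_sub_le hω hl0.le (fun v => (h₀.1 v).trans (min_le_left _ _)) hB
    have hlc : multiplier s n c 1 * ∑ e ∈ B, ω.cost e ≤ limitWeight s n c := by
      refine (mul_le_mul_of_nonneg_left hBc hl0.le).trans_eq ?_
      rw [multiplier]
      field_simp
    have a₀ := abs_le.1 (h₀.abs_sub_le hs hn0 hc one_pos)
    have hη2 : η ^ 2 * limitWeight s n c ≤ η * (1 / 20) * limitWeight s n c := by
      rw [sq]; gcongr
    have := mul_pos hη hVpos
    linarith [a₀.1]
  have hw0 : 0 ≤ w' := le_trans (mul_nonneg (by linarith) hVpos.le) hlower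
  refine ⟨w', hopt, ?_, ?_⟩
  · calc (1 - ε) * w' ≤ (1 - 19 * η) * w' := by gcongr
      _ ≤ (1 - 19 * η) * ((1 + 19 * η) * limitWeight s n c) := by
          have : 0 ≤ 1 - 19 * η := by linarith
          gcongr
      _ ≤ limitWeight s n c := by nlinarith [mul_nonneg (sq_nonneg η) hVpos.le]
  · calc limitWeight s n c ≤ (1 + 19 * η) * ((1 - 2 * η) * limitWeight s n c) := by
          have : 1 ≤ (1 + 19 * η) * (1 - 2 * η) := by nlinarith
          nlinarith
      _ ≤ (1 + ε) * w' := mul_le_mul (by linarith) hlower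
          (mul_nonneg (by linarith) hVpos.le) (by linarith)

/-! ### Transfer from the given random variables to the block model. -/

theorem prod_edge {M : Type*} [CommMonoid M] {n : ℕ} (g : Edge n → M) :
    ∏ e, g e = ∏ v : Fin n, ∏ u : {u : Fin n // u ≠ v}, g ⟨(u, v), u.2⟩ := by
  rw [← Fintype.prod_sigma' (fun (v : Fin n) (u : {u : Fin n // u ≠ v}) => g ⟨(u, v), u.2⟩)]
  symm
  exact Fintype.prod_equiv
    { toFun := fun p : Σ v : Fin n, {u : Fin n // u ≠ v} => (⟨(p.2, p.1), p.2.2⟩ : Edge n)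
      invFun := fun e => ⟨e.1.2, ⟨e.1.1, e.2⟩⟩
      left_inv := fun _ => rfl
      right_inv := fun _ => rfl } _ _ fun _ => rfl

/-- Grouping the weights and the costs by the head of the edge. -/
def toInBlocks {n : ℕ} (x : Edge n ⊕ Edge n → ℝ) : InBlocks n :=
  fun v u => (x (Sum.inl ⟨(u, v), u.2⟩), x (Sum.inr ⟨(u, v), u.2⟩))

theorem measurable_toInBlocks {n : ℕ} : Measurable (toInBlocks (n := n)) := by
  unfold toInBlocks
  fun_prop

/-- It is easier to push `modelLaw` forward along the inverse map: preimages of boxes are products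
of boxes, so `Measure.pi_eq` identifies the image. -/
theorem map_toInBlocks (s : ℝ) (n : ℕ) :
    (Measure.pi fun _ : Edge n ⊕ Edge n => uniformPow s).map toInBlocks = modelLaw s n := by
  set Φ : InBlocks n → Edge n ⊕ Edge n → ℝ := fun ω => Sum.elim ω.weight ω.cost with hΦ
  have hΦm : Measurable Φ := by
    refine measurable_pi_iff.2 fun i => ?_
    rcases i with e | e
    · simp only [hΦ, Sum.elim_inl, InBlocks.weight]
      fun_prop
    · simp only [hΦ, Sum.elim_inr, InBlocks.cost]
      fun_prop
  have hlaw : Measure.pi (fun _ : Edge n ⊕ Edge n => uniformPow s) = (modelLaw s n).map Φ := by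
    refine Measure.pi_eq fun B hB => ?_
    rw [Measure.map_apply hΦm (MeasurableSet.univ_pi hB)]
    have hpre : Φ ⁻¹' Set.pi Set.univ B = Set.pi Set.univ fun v : Fin n =>
        Set.pi Set.univ fun u : {u : Fin n // u ≠ v} =>
          B (Sum.inl ⟨(u, v), u.2⟩) ×ˢ B (Sum.inr ⟨(u, v), u.2⟩) := by
      ext ω
      simp only [Set.mem_preimage, Set.mem_univ_pi, Set.mem_prod]
      constructor
      · exact fun h v u => ⟨h (Sum.inl ⟨(u, v), u.2⟩), h (Sum.inr ⟨(u, v), u.2⟩)⟩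
      · rintro h (e | e)
        · exact (h e.1.2 ⟨e.1.1, e.2⟩).1
        · exact (h e.1.2 ⟨e.1.1, e.2⟩).2
    rw [hpre, modelLaw, Measure.pi_pi]
    simp_rw [blockLaw, Measure.pi_pi, edgeLaw, Measure.prod_prod]
    rw [Fintype.prod_sum_type, prod_edge, prod_edge, ← Finset.prod_mul_distrib]
    simp_rw [Finset.prod_mul_distrib]
  rw [hlaw, Measure.map_map measurable_toInBlocks hΦm]
  exact Measure.map_id

/-- Probabilities of events about i.i.d. weights and costs are computed under `modelLaw`. -/
theorem measure_le_modelLaw {s : ℝ} {n : ℕ} {Ω : Type*} [MeasurableSpace Ω] {P : Measure Ω}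
    [IsProbabilityMeasure P] {W C : Edge n → Ω → ℝ}
    (hW : ∀ e, HasLaw (W e) (uniformPow s) P) (hC : ∀ e, HasLaw (C e) (uniformPow s) P)
    (hindep : iIndepFun (Sum.elim W C) P) (B : Set (InBlocks n)) :
    P {ω | toInBlocks (Sum.elim (fun e => W e ω) fun e => C e ω) ∈ B} ≤ modelLaw s n B := by
  have hlaw : ∀ i, HasLaw (Sum.elim W C i) (uniformPow s) P := by
    rintro (e | e)
    · exact hW e
    · exact hC e
  have hmeas : AEMeasurable (fun ω i => Sum.elim W C i ω) P :=
    aemeasurable_pi_lambda _ fun i => (hlaw i).aemeasurable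
  have hmap : P.map (fun ω i => Sum.elim W C i ω) = Measure.pi fun _ => uniformPow s := by
    rw [hindep.map_fun_eq_pi_map fun i => (hlaw i).aemeasurable]
    simp_rw [fun i => (hlaw i).map_eq]
  have hmap2 : P.map (toInBlocks ∘ fun ω i => Sum.elim W C i ω) = modelLaw s n := by
    rw [← AEMeasurable.map_map_of_aemeasurable measurable_toInBlocks.aemeasurable hmeas, hmap,
      map_toInBlocks]
  rw [← hmap2]
  -- This inequality holds for arbitrary sets, so `B` need not be measurable.
  refine le_trans (le_of_eq ?_)
    (Measure.le_map_apply (measurable_toInBlocks.comp_aemeasurable hmeas) B)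
  congr 1

/-! ### Asymptotics in the prescribed range of `c₀`. -/

section Asymptotic

variable {s : ℝ} {c : ℕ → ℝ}

theorem tendsto_div_of_isLittleO_left (hpos : ∀ᶠ n in atTop, 0 < c n)
    (hlow : (fun n : ℕ => (n : ℝ) ^ (1 - s) * Real.log n) =o[atTop] c) :
    Tendsto (fun n : ℕ => c n / ((n : ℝ) ^ (1 - s) * Real.log n)) atTop atTop := by
  have h := hlow.tendsto_div_nhds_zero
  have h2 : ∀ᶠ n : ℕ in atTop, 0 < (n : ℝ) ^ (1 - s) * Real.log n / c n := by
    filter_upwards [hpos, eventually_ge_atTop 2] with n hc hn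
    have hn' : (1 : ℝ) < n := by exact_mod_cast hn
    have := Real.log_pos hn'
    positivity
  refine (tendsto_nhdsWithin_iff.2 ⟨h, h2⟩).inv_tendsto_nhdsGT_zero.congr fun n => ?_
  simp

theorem tendsto_div_of_isLittleO_right (hpos : ∀ᶠ n in atTop, 0 < c n)
    (hupp : c =o[atTop] (fun n : ℕ => (n : ℝ) / Real.log n)) :
    Tendsto (fun n : ℕ => (n : ℝ) / Real.log n / c n) atTop atTop := by
  have h := hupp.tendsto_div_nhds_zero
  have h2 : ∀ᶠ n : ℕ in atTop, 0 < c n / ((n : ℝ) / Real.log n) := by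
    filter_upwards [hpos, eventually_ge_atTop 2] with n hc hn
    have hn' : (1 : ℝ) < n := by exact_mod_cast hn
    have := Real.log_pos hn'
    positivity
  refine (tendsto_nhdsWithin_iff.2 ⟨h, h2⟩).inv_tendsto_nhdsGT_zero.congr fun n => ?_
  simp

theorem eventually_one_le_log : ∀ᶠ n : ℕ in atTop, 1 ≤ Real.log n :=
  (Real.tendsto_log_atTop.comp tendsto_natCast_atTop_atTop).eventually_ge_atTop 1

/-- Up to a constant the product is `(n / c) ^ 2 / log n ^ s`, which dominates the square of `n /
log n / c` because `s ≤ 2`. The companion `tendsto_div_multiplier` uses the lower bound on `c` in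
the same way. -/
theorem tendsto_multiplier_mul (hs0 : 0 < s) (hs1 : s ≤ 1) (hpos : ∀ᶠ n in atTop, 0 < c n)
    (hright : Tendsto (fun n : ℕ => (n : ℝ) / Real.log n / c n) atTop atTop)
    {q : ℝ} (hq : 0 < q) :
    Tendsto (fun n : ℕ => multiplier s n (c n) q * ((n : ℝ) / Real.log n) ^ s) atTop atTop := by
  have hC := Cs_pos hs0
  refine tendsto_atTop_mono' _ ?_ ((((tendsto_pow_atTop two_ne_zero).comp hright)).const_mul_atTop
    (show 0 < q ^ 2 * Cs s ^ 2 / 4 by positivity))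
  filter_upwards [hpos, eventually_ge_atTop 2, eventually_one_le_log] with n hc hn hlog
  have hn0 : (0 : ℝ) < n := by exact_mod_cast (by omega : 0 < n)
  have hlog0 : 0 < Real.log n := by linarith
  have e : multiplier s n (c n) q * ((n : ℝ) / Real.log n) ^ s =
      q ^ 2 * Cs s ^ 2 / 4 * ((n : ℝ) ^ 2 / c n ^ 2 / Real.log n ^ s) := by
    rw [multiplier, limitWeight, Real.div_rpow hn0.le hlog0.le, Real.rpow_sub hn0,
      show (n : ℝ) ^ (2 : ℝ) = (n : ℝ) ^ 2 by exact_mod_cast Real.rpow_natCast (n : ℝ) 2]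
    have h1 : 0 < (n : ℝ) ^ s := Real.rpow_pos_of_pos hn0 s
    have h2 : 0 < Real.log n ^ s := Real.rpow_pos_of_pos hlog0 s
    field_simp
  have hls : Real.log n ^ s ≤ Real.log n ^ 2 := by
    rw [← Real.rpow_natCast]
    exact Real.rpow_le_rpow_of_exponent_le hlog (by push_cast; linarith)
  rw [e, Function.comp_apply, div_pow, div_pow, div_right_comm]
  gcongr

theorem tendsto_div_multiplier (hs0 : 0 < s) (hs1 : s ≤ 1) (hpos : ∀ᶠ n in atTop, 0 < c n)
    (hleft : Tendsto (fun n : ℕ => c n / ((n : ℝ) ^ (1 - s) * Real.log n)) atTop atTop)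
    {q : ℝ} (hq : 0 < q) :
    Tendsto (fun n : ℕ => ((n : ℝ) / Real.log n) ^ s / multiplier s n (c n) q) atTop atTop := by
  have hC := Cs_pos hs0
  refine tendsto_atTop_mono' _ ?_ ((((tendsto_pow_atTop two_ne_zero).comp hleft)).const_mul_atTop
    (show 0 < 4 / (q ^ 2 * Cs s ^ 2) by positivity))
  filter_upwards [hpos, eventually_ge_atTop 2, eventually_one_le_log] with n hc hn hlog
  have hn0 : (0 : ℝ) < n := by exact_mod_cast (by omega : 0 < n)
  have hlog0 : 0 < Real.log n := by linarith
  have hn1 : 0 < (n : ℝ) ^ (1 - s) := Real.rpow_pos_of_pos hn0 _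
  have e : ((n : ℝ) / Real.log n) ^ s / multiplier s n (c n) q =
      4 / (q ^ 2 * Cs s ^ 2) * (c n ^ 2 / (((n : ℝ) ^ (1 - s)) ^ 2 * Real.log n ^ s)) := by
    rw [multiplier, limitWeight, Real.div_rpow hn0.le hlog0.le, Real.rpow_sub hn0,
      Real.rpow_sub hn0, Real.rpow_one,
      show (n : ℝ) ^ (2 : ℝ) = (n : ℝ) ^ 2 by exact_mod_cast Real.rpow_natCast (n : ℝ) 2]
    have h1 : 0 < (n : ℝ) ^ s := Real.rpow_pos_of_pos hn0 s
    have h2 : 0 < Real.log n ^ s := Real.rpow_pos_of_pos hlog0 s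
    field_simp
  have hls : Real.log n ^ s ≤ Real.log n ^ 2 := by
    rw [← Real.rpow_natCast]
    exact Real.rpow_le_rpow_of_exponent_le hlog (by push_cast; linarith)
  rw [e, Function.comp_apply, div_pow, mul_pow]
  gcongr

/-- This makes the cycle repairs negligible in both cost and weight. Since `s ≤ 1`, the factor `n ^
(1 - s)` is at least 1 and can be dropped. -/
theorem tendsto_min_div_log (hs0 : 0 < s) (hs1 : s ≤ 1) (hpos : ∀ᶠ n in atTop, 0 < c n)
    (hleft : Tendsto (fun n : ℕ => c n / ((n : ℝ) ^ (1 - s) * Real.log n)) atTop atTop)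
    (hright : Tendsto (fun n : ℕ => (n : ℝ) / Real.log n / c n) atTop atTop) :
    Tendsto (fun n : ℕ => min (c n) (limitWeight s n (c n)) / Real.log n) atTop atTop := by
  have hC := Cs_pos hs0
  have h2 := hright.const_mul_atTop (show 0 < Cs s ^ 2 / 4 by positivity)
  refine tendsto_atTop.2 fun b => ?_
  filter_upwards [hpos, eventually_ge_atTop 2, eventually_one_le_log,
    hleft.eventually_ge_atTop (max b 0), h2.eventually_ge_atTop (max b 0)] with n hc hn hlog h1 h2
  have hn0 : (1 : ℝ) ≤ n := by exact_mod_cast (by omega : 1 ≤ n)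
  have hlog0 : 0 < Real.log n := by linarith
  have hn1 : 1 ≤ (n : ℝ) ^ (1 - s) := Real.one_le_rpow hn0 (by linarith)
  rw [le_div_iff₀ hlog0]
  refine (mul_le_mul_of_nonneg_right (le_max_left b 0) hlog0.le).trans (le_min ?_ ?_)
  · rw [le_div_iff₀ (by positivity)] at h1
    refine le_trans ?_ h1
    have := mul_le_mul_of_nonneg_right hn1 hlog0.le
    rw [one_mul] at this
    exact mul_le_mul_of_nonneg_left this (le_max_right _ _)
  · have hV : limitWeight s n (c n) =
        (n : ℝ) ^ (1 - s) * (Cs s ^ 2 / 4 * (n / Real.log n / c n) * Real.log n) := by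
      have e : (n : ℝ) ^ (2 - s) = (n : ℝ) ^ (1 - s) * n := by
        rw [← Real.rpow_add_one (by positivity)]; congr 1; ring
      rw [limitWeight, e]
      field_simp
    rw [hV]
    have h3 := mul_le_mul_of_nonneg_right h2 hlog0.le
    refine h3.trans (le_mul_of_one_le_left (le_trans ?_ h3) hn1)
    exact mul_nonneg (le_max_right _ _) hlog0.le

/-- For each fixed accuracy the minimum weight is close to its asymptotic value. -/
theorem tendsto_modelLaw_not_goodOptimum (hs0 : 0 < s) (hs1 : s ≤ 1)
    (hpos : ∀ᶠ n in atTop, 0 < c n)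
    (hlow : (fun n : ℕ => (n : ℝ) ^ (1 - s) * Real.log n) =o[atTop] c)
    (hupp : c =o[atTop] (fun n : ℕ => (n : ℝ) / Real.log n)) {ε : ℝ} (hε : 0 < ε) :
    Tendsto (fun n => modelLaw s n {ω | ¬ GoodOptimum s (c n) ε ω.weight ω.cost})
      atTop (𝓝 0) := by
  have hleft := tendsto_div_of_isLittleO_left hpos hlow
  have hright := tendsto_div_of_isLittleO_right hpos hupp
  have hC := Cs_pos hs0
  obtain ⟨η, hη, hη1, hηε⟩ : ∃ η : ℝ, 0 < η ∧ η ≤ 1 / 20 ∧ 19 * η ≤ ε :=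
    ⟨min (1 / 20) (ε / 19), by positivity, min_le_left _ _,
      by linarith [min_le_right (1 / 20) (ε / 19)]⟩
  have hconc : ∀ q : ℝ, 0 < q → Tendsto (fun n => modelLaw s n
      {ω | ¬ Concentrated s (η ^ 2 * Cs s) (multiplier s n (c n) q) ω}) atTop (𝓝 0) := by
    intro q hq
    refine tendsto_modelLaw_not_concentrated hs0 ?_
      (tendsto_multiplier_mul hs0 hs1 hpos hright hq) (tendsto_div_multiplier hs0 hs1 hpos hleft hq)
      (by positivity)
    filter_upwards [hpos, eventually_gt_atTop 0] with n hc hn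
    exact multiplier_pos hs0 hn hc hq
  have hmin := tendsto_min_div_log hs0 hs1 hpos hleft hright
  have hcyc : Tendsto (fun n => modelLaw s n {ω | η * min (c n) (limitWeight s n (c n)) ≤
      (cycleTops (multiplier s n (c n) (1 + 10 * η)) ω).card}) atTop (𝓝 0) := by
    -- The 3 comes from `2 + log n ≤ 3 * log n` in Markov's bound.
    have hlim : Tendsto (fun n : ℕ => ENNReal.ofReal
        (3 / η * (min (c n) (limitWeight s n (c n)) / Real.log n)⁻¹)) atTop (𝓝 0) := by
      simpa using ENNReal.tendsto_ofReal (hmin.inv_tendsto_atTop.const_mul (3 / η))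
    refine tendsto_of_tendsto_of_tendsto_of_le_of_le' tendsto_const_nhds hlim
      (Eventually.of_forall fun _ => zero_le) ?_
    filter_upwards [hpos, eventually_ge_atTop 2, eventually_one_le_log] with n hc hn hlog
    have hV := limitWeight_pos hs0 (by omega : 0 < n) hc
    have hm : 0 < min (c n) (limitWeight s n (c n)) := lt_min hc hV
    refine (modelLaw_card_cycleTops_le hs0 _ hn (by positivity)).trans
      (ENNReal.ofReal_le_ofReal ?_)
    rw [inv_div, div_mul_div_comm]
    gcongr
    linarith
  have hV : ∀ᶠ n : ℕ in atTop, 1 ≤ η * limitWeight s n (c n) := by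
    filter_upwards [hmin.eventually_ge_atTop η⁻¹, eventually_one_le_log] with n h hlog
    rw [le_div_iff₀ (by linarith)] at h
    have h1 : η⁻¹ ≤ η⁻¹ * Real.log n := le_mul_of_one_le_right (by positivity) hlog
    have h2 := (h1.trans h).trans (min_le_right _ _)
    rwa [← inv_le_iff_one_le_mul₀' hη]
  have hsum := (((hconc 1 one_pos).add (hconc (1 + 10 * η) (by linarith))).add
    ((hconc ((1 + 10 * η) * (1 - η)) (mul_pos (by linarith) (by linarith))).add
      (hconc ((1 + 10 * η) * (1 + η)) (by positivity)))).add hcyc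
  simp only [add_zero] at hsum
  refine tendsto_of_tendsto_of_tendsto_of_le_of_le' tendsto_const_nhds hsum
    (Eventually.of_forall fun _ => zero_le) ?_
  filter_upwards [hpos, hV, eventually_ge_atTop 2] with n hc hV hn
  refine le_trans (measure_mono_ae ?_) ((measure_union_le _ _).trans (add_le_add
    ((measure_union_le _ _).trans (add_le_add (measure_union_le _ _) (measure_union_le _ _)))
    le_rfl))
  filter_upwards [ae_inUnit hs0 n] with ω hω hbad
  by_contra hcon
  have hcon' : ω ∉ (((_ ∪ _) ∪ (_ ∪ _)) ∪ _ : Set (InBlocks n)) := hcon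
  simp only [Set.mem_union, Set.mem_ofPred_eq, not_or, not_not, not_le] at hcon'
  obtain ⟨⟨⟨h₀, h₁⟩, h₂, h₃⟩, hD⟩ := hcon'
  exact hbad (goodOptimum_of_concentrated hs0 hn hc hη hη1 hηε hV hω h₀ h₁ h₂ h₃ hD.le)

end Asymptotic

/-! ### Diagonalisation and conclusion. -/

/-- If for each fixed accuracy the probability of failure tends to zero, then so it does for some
accuracy that tends to zero. -/
theorem exists_tendsto_zero_of_forall {p : ℕ → ℝ → ENNReal}
    (h : ∀ ε, 0 < ε → Tendsto (fun n => p n ε) atTop (𝓝 0)) :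
    ∃ ε : ℕ → ℝ, Tendsto ε atTop (𝓝 0) ∧ Tendsto (fun n => p n (ε n)) atTop (𝓝 0) := by
  -- Accuracies that bound their own failure probability. Any fixed `δ > 0` eventually belongs to `S
  -- n`, so a choice close to `sInf (S n)` tends to 0 and takes the failure probability with it.
  set S : ℕ → Set ℝ := fun n => {δ | 0 < δ ∧ p n δ ≤ ENNReal.ofReal δ} with hS
  have hev : ∀ δ, 0 < δ → ∀ᶠ n in atTop, δ ∈ S n := fun δ hδ =>
    ((h δ hδ).eventually_le_const (ENNReal.ofReal_pos.2 hδ)).mono fun n hn => ⟨hδ, hn⟩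
  have hbdd : ∀ n, BddBelow (S n) := fun n => ⟨0, fun δ hδ => hδ.1.le⟩
  have hchoose : ∀ n, ∃ ε, (S n).Nonempty → ε ∈ S n ∧ ε < sInf (S n) + 1 / ((n : ℝ) + 1) := by
    intro n
    by_cases hne : (S n).Nonempty
    · obtain ⟨ε, hε, hlt⟩ := exists_lt_of_csInf_lt hne
        (show sInf (S n) < sInf (S n) + 1 / ((n : ℝ) + 1) from
          lt_add_of_pos_right _ (by positivity))
      exact ⟨ε, fun _ => ⟨hε, hlt⟩⟩
    · exact ⟨0, fun h => absurd h hne⟩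
  choose ε hε using hchoose
  have hε0 : Tendsto ε atTop (𝓝 0) := by
    refine Metric.tendsto_atTop'.2 fun δ hδ => ?_
    have h1 := (tendsto_one_div_add_atTop_nhds_zero_nat (𝕜 := ℝ)).eventually_lt_const (half_pos hδ)
    obtain ⟨N, hN⟩ := eventually_atTop.1 ((hev (δ / 2) (half_pos hδ)).and h1)
    refine ⟨N, fun n hn => ?_⟩
    obtain ⟨h2, h3⟩ := hN n hn.le
    obtain ⟨h4, h5⟩ := hε n ⟨_, h2⟩
    have h6 := csInf_le (hbdd n) h2
    rw [Real.dist_eq, sub_zero, abs_of_pos h4.1]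
    linarith
  refine ⟨ε, hε0, ?_⟩
  refine tendsto_of_tendsto_of_tendsto_of_le_of_le' tendsto_const_nhds
    (by simpa using ENNReal.tendsto_ofReal hε0) (Eventually.of_forall fun _ => zero_le) ?_
  filter_upwards [hev 1 one_pos] with n hn
  exact (hε n ⟨_, hn⟩).1.2

end CostArb

theorem theorem2 (s : ℝ) (hs0 : 0 < s) (hs1 : s ≤ 1)
    -- the random model, for every number `n` of vertices
    {Ω : ℕ → Type*} [∀ n, MeasurableSpace (Ω n)]
    (P : ∀ n, Measure (Ω n)) [∀ n, IsProbabilityMeasure (P n)]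
    (W C : ∀ n, CostArb.Edge n → Ω n → ℝ)
    (hW : ∀ n e, HasLaw (W n e) (CostArb.uniformPow s) (P n))
    (hC : ∀ n e, HasLaw (C n e) (CostArb.uniformPow s) (P n))
    (hindep : ∀ n, iIndepFun (Sum.elim (W n) (C n)) (P n))
    -- the cost bound, `n ^ (1 - s) * log n ≪ c₀ ≪ n / log n`
    (c₀ : ℕ → ℝ) (hpos : ∀ᶠ n in atTop, 0 < c₀ n)
    (hlow : (fun n : ℕ => (n : ℝ) ^ (1 - s) * Real.log n) =o[atTop] c₀)
    (hupp : c₀ =o[atTop] (fun n : ℕ => (n : ℝ) / Real.log n)) :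
    ∃ ε : ℕ → ℝ, Tendsto ε atTop (𝓝 0) ∧
      Tendsto
        (fun n : ℕ => P n {ω | ∃ w : ℝ,
          CostArb.IsOptimalWeight (fun e => W n e ω) (fun e => C n e ω) (c₀ n) w ∧
          (1 - ε n) * w ≤ CostArb.Cs s ^ 2 * (n : ℝ) ^ (2 - s) / (4 * c₀ n) ∧
          CostArb.Cs s ^ 2 * (n : ℝ) ^ (2 - s) / (4 * c₀ n) ≤ (1 + ε n) * w})
        atTop (𝓝 1) := by
  obtain ⟨ε, hε, hp⟩ := CostArb.exists_tendsto_zero_of_forall fun ε hε =>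
    CostArb.tendsto_modelLaw_not_goodOptimum (ε := ε) hs0 hs1 hpos hlow hupp hε
  refine ⟨ε, hε, ?_⟩
  have h1 : Tendsto (fun n => 1 - CostArb.modelLaw s n
      {ω | ¬ CostArb.GoodOptimum s (c₀ n) (ε n) ω.weight ω.cost}) atTop (𝓝 1) := by
    simpa using ENNReal.Tendsto.sub tendsto_const_nhds hp (Or.inl ENNReal.one_ne_top)
  refine tendsto_of_tendsto_of_tendsto_of_le_of_le h1 tendsto_const_nhds (fun n => ?_)
    fun n => prob_le_one
  have h2 := CostArb.measure_le_modelLaw (hW n) (hC n) (hindep n)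
    {ω | ¬ CostArb.GoodOptimum s (c₀ n) (ε n) ω.weight ω.cost}
  refine tsub_le_iff_right.2 (le_trans ?_ (add_le_add_right h2 _))
  -- Subadditivity replaces the complement rule, so the good event need not be shown measurable.
  rw [← measure_univ (μ := P n)]
  refine (measure_mono fun ω _ => ?_).trans (measure_union_le _ _)
  by_cases hg : CostArb.GoodOptimum s (c₀ n) (ε n) (fun e => W n e ω) fun e => C n e ω
  · exact Or.inl hg
  · exact Or.inr hg
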